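/- All graphs are finite and simple. For a graph $G$, let $D(G)$ be the diagonal matrix of its vertex degrees and $A(G)$ its adjacency matrix, and let $q(G)$ be the largest eigenvalue of the signless Laplacian matrix $Q(G)=D(G)+A(G)$. The graph $G$ is called $k$-path-coverable if $V(G)$ is the union of the vertex sets of at most $k$ pairwise vertex-disjoint paths of $G$ (a single vertex counts as a path). Let $$B(n,k,\delta)=K_\delta\vee\bigl(K_{n-2\delta-k}\cup\overline{K_{\delta+k}}\bigr),$$ where $\cup$ is disjoint union and $\vee$ is join, and let $E_1$ be the set of those edges of $B(n,k,\delta)$ that have no end among the $\delta+k$ vertices of $\overline{K_{\delta+k}}$ (so $E_1$ is the edge set of a clique $K_{n-\delta-k}$). Let $\mathcal B_1(n,k,\delta)$ be the family of all graphs isomorphic to $B(n,k,\delta)-E'$ for some $E'\subseteq E_1$ with $|E'|\le\lfloor\delta(\delta+k)/4\rfloor$. **Theorem.** Let $k\ge1$ and $\delta\ge2$ be integers, and let $G$ be a connected graph on $$n\ge(\delta^2+k\delta+7\delta+6k+9)(\delta^2+k\delta+1)$$ vertices with minimum degree at least $\delta$. Suppose that $q(G)\ge 2(n-\delta-k-1)$.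 Then $G$ is $k$-path-coverable unless $G\in\mathcal B_1(n,k,\delta)$, and in that case $G$ is not $k$-path-coverable; that is, $G$ is $k$-path-coverable if and only if $G\notin\mathcal B_1(n,k,\delta)$. -/

import Mathlib

namespace PathCover

/-- The signless Laplacian matrix `Q(G) = D(G) + A(G)`. -/
def signlessLaplacian {V : Type*} [Fintype V] [DecidableEq V] (G : SimpleGraph V)
    [DecidableRel G.Adj] : Matrix V V ℝ :=
  G.degMatrix ℝ + G.adjMatrix ℝ

/-- The `Q`-index `q(G)`: the largest eigenvalue of the signless Laplacian matrix
(see `isGreatest_qIndex` below: on a nonempty vertex set the supremum is attained). -/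
noncomputable def qIndex {V : Type*} [Fintype V] [DecidableEq V] (G : SimpleGraph V)
    [DecidableRel G.Adj] : ℝ :=
  sSup {μ : ℝ | Module.End.HasEigenvalue (Matrix.toLin' (signlessLaplacian G)) μ}

theorem isHermitian_signlessLaplacian {V : Type*} [Fintype V] [DecidableEq V]
    (G : SimpleGraph V) [DecidableRel G.Adj] : (signlessLaplacian G).IsHermitian :=
  (G.isHermitian_degMatrix ℝ).add (by
    rw [Matrix.IsHermitian, Matrix.conjTranspose_eq_transpose_of_trivial]
    exact G.isSymm_adjMatrix)

theorem isGreatest_qIndex {V : Type*} [Fintype V] [DecidableEq V] [Nonempty V]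
    (G : SimpleGraph V) [DecidableRel G.Adj] :
    IsGreatest {μ : ℝ | Module.End.HasEigenvalue (Matrix.toLin' (signlessLaplacian G)) μ}
      (qIndex G) := by
  have hne : {μ : ℝ |
      Module.End.HasEigenvalue (Matrix.toLin' (signlessLaplacian G)) μ}.Nonempty := by
    have h := isHermitian_signlessLaplacian G
    obtain ⟨i⟩ := (inferInstance : Nonempty V)
    refine ⟨h.eigenvalues i, ?_⟩
    refine Module.End.hasEigenvalue_of_hasEigenvector (x := ⇑(h.eigenvectorBasis i)) ?_
    refine ⟨Module.End.mem_eigenspace_iff.2 ?_, ?_⟩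
    · rw [Matrix.toLin'_apply]
      exact h.mulVec_eigenvectorBasis i
    · intro h0
      apply h.eigenvectorBasis.orthonormal.ne_zero i
      ext j
      exact congrFun h0 j
  have hfin := Module.End.finite_hasEigenvalue (f := Matrix.toLin' (signlessLaplacian G))
  exact ⟨hne.csSup_mem hfin, fun μ hμ => le_csSup hfin.bddAbove hμ⟩

/-- `G` is `k`-path-coverable: there are `m ≤ k` pairwise vertex-disjoint paths of `G`
(a single vertex counts as a path) that together contain every vertex. -/
def IsPathCoverable {V : Type*} (G : SimpleGraph V) (k : ℕ) : Prop :=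
  ∃ m : ℕ, m ≤ k ∧ ∃ (a b : Fin m → V) (p : ∀ i, G.Walk (a i) (b i)),
    (∀ i, (p i).IsPath) ∧
    (∀ i j, i ≠ j → List.Disjoint (p i).support (p j).support) ∧
    ∀ v, ∃ i, v ∈ (p i).support

/-- The join `G ∨ H`: the disjoint union together with all edges between the two parts. -/
def join {V W : Type*} (G : SimpleGraph V) (H : SimpleGraph W) : SimpleGraph (V ⊕ W) :=
  (G ⊕g H) ⊔ completeBipartiteGraph V W

/-- The vertex set of `B(n,k,δ)`: the three summands are the parts `Y`, `Z`, `X`, of sizes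
`δ`, `n - 2δ - k` and `δ + k`, so that there are `n` vertices whenever `2δ + k ≤ n`. -/
abbrev BVert (n k δ : ℕ) : Type := Fin δ ⊕ (Fin (n - 2 * δ - k) ⊕ Fin (δ + k))

/-- The graph `B(n,k,δ) = K_δ ∨ (K_{n-2δ-k} ∪ (δ+k)K₁)`. -/
def graphB (n k δ : ℕ) : SimpleGraph (BVert n k δ) :=
  join (⊤ : SimpleGraph (Fin δ))
    ((⊤ : SimpleGraph (Fin (n - 2 * δ - k))) ⊕g (⊥ : SimpleGraph (Fin (δ + k))))

/-- The set `X` of the `δ + k` independent vertices of `B(n,k,δ)`. -/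
def partX (n k δ : ℕ) : Set (BVert n k δ) := Set.range (fun x => Sum.inr (Sum.inr x))

/-- The set `E₁` of edges of `B(n,k,δ)` with both ends in `Y ∪ Z`, the complement of `X`;
these are the edges of the clique `K_{n-δ-k}` on `Y ∪ Z`. -/
def cliqueEdges (n k δ : ℕ) : Set (Sym2 (BVert n k δ)) :=
  {e ∈ (graphB n k δ).edgeSet | ∀ v ∈ e, v ∉ partX n k δ}

/-- Membership in the family `𝓑₁(n,k,δ)`: up to isomorphism, `G` is obtained from `B(n,k,δ)`
by deleting a set `E'` of at most `⌊δ(δ+k)/4⌋` edges from `E₁`. -/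
def MemFamilyB1 (n k δ : ℕ) {V : Type*} (G : SimpleGraph V) : Prop :=
  ∃ E' : Finset (Sym2 (BVert n k δ)),
    (E' : Set (Sym2 (BVert n k δ))) ⊆ cliqueEdges n k δ ∧
    E'.card ≤ δ * (δ + k) / 4 ∧
    Nonempty (G ≃g (graphB n k δ).deleteEdges (E' : Set (Sym2 (BVert n k δ))))

end PathCover

/-!
Write `t = δ + k`. A `k`-path cover amounts to a list of all vertices with fewer than `k` *breaks*,
that is, consecutive entries that are not adjacent.

Members of `𝓑₁` have no such list: deleting the `δ` vertices of `Y` from `k` disjoint paths leaves at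
most `t` pieces, but the `t` vertices of `X` and the nonempty rest need `t + 1` of them
(`MemFamilyB1.not_hasArrangement`).

Conversely let `G` not be `k`-path-coverable. At a vertex `u` maximizing `|x u| / deg u` for an
eigenvector `x`, the eigenvalue equation yields `q(G) ≤ deg u + (∑_{v ~ u} deg v) / deg u`, so that a
large index forces `G` to miss at most `t (n - 1)` edges (`le_sum_degree_of_le_qIndex`). Pass to an
edge-maximal non-coverable graph `H ⊇ G`. In it non-adjacent vertices have degree sum at most
`n - k - 1`, by the rotation argument of Ore's theorem (`countP_ends_le`, `degree_add_degree_lt`).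
Hence the vertices of large degree form a clique, and counting the non-adjacent pairs shows that the
set `L` of the other vertices has exactly `t` elements, all of degree `δ`. The neighbours of `L`
outside `L` form a set `Y` that is completely joined to `L`. If `|Y| < δ`, then the same rotation
argument inside `L` provides a cover of `L` by at most `k + |Y| - 1` paths, and `Y` connects them to a
`k`-path cover of `H`; so `|Y| = δ` and `L` is independent
(`exists_independent_of_not_hasArrangement`).

It remains to bound the number of edges missing from the clique on the `N = n - t` vertices outside
`X = L`. Scale an eigenvector to have sum `N` outside `X`, so that it is `1 + b` there with
`∑ b = 0`. Compared with `2 (N - 1) ∑ x²`, the signless Laplacian form loses `4` for every missing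
edge and gains at most `1` for each of the `δ t` edges between `X` and `Y`, up to terms linear in `b`
and an error of order `δ² t / N`. As the clique contributes `-N ∑ b²`, the linear terms cost
`O((δ t)² / N)`. All errors add up to less than `1` for `n` as large as assumed, so an index of at
least `2 (N - 1)` allows at most `δ t / 4` missing edges (`rayleigh_le`, `quadratic_form_bound`,
`four_mul_card_edgeFinset_le`).
-/

namespace PathCover

/-! ### Breaks of a list of vertices -/

variable {V : Type*} (G : SimpleGraph V)

open Classical in
/-- The number of pairs of consecutive, but non-adjacent, entries of a list of vertices. A list
without repetitions that has `b` breaks is the concatenation of `b + 1` vertex-disjoint paths. -/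
noncomputable def breaks : List V → ℕ
  | a :: b :: l => (if G.Adj a b then 0 else 1) + breaks (b :: l)
  | _ => 0

/-- The vertices can be arranged in a list with fewer than `k` breaks. On a nonempty vertex set
this is `k`-path-coverability, see `isPathCoverable_of_hasArrangement` and
`IsPathCoverable.hasArrangement`. -/
def HasArrangement (k : ℕ) : Prop :=
  ∃ w : List V, w.Nodup ∧ (∀ v, v ∈ w) ∧ breaks G w < k

@[simp]
theorem breaks_nil : breaks G [] = 0 := rfl

@[simp]
theorem breaks_singleton (a : V) : breaks G [a] = 0 := rfl

open Classical in
theorem breaks_cons_cons (a b : V) (l : List V) :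
    breaks G (a :: b :: l) = (if G.Adj a b then 0 else 1) + breaks G (b :: l) := rfl

open Classical in
theorem breaks_append_cons_cons (A : List V) (a b : V) (B : List V) :
    breaks G (A ++ a :: b :: B) =
      breaks G (A ++ [a]) + (if G.Adj a b then 0 else 1) + breaks G (b :: B) := by
  induction A with
  | nil => simp [breaks_cons_cons]
  | cons c A ih =>
    cases A with
    | nil => simp only [List.cons_append, List.nil_append, breaks_cons_cons, breaks_singleton]; ring
    | cons d A =>
      simp only [List.cons_append, breaks_cons_cons] at ih ⊢
      rw [ih]; ring

theorem breaks_append_of_adj {l₁ l₂ : List V}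
    (h : ∀ a ∈ l₁.getLast?, ∀ b ∈ l₂.head?, G.Adj a b) :
    breaks G (l₁ ++ l₂) = breaks G l₁ + breaks G l₂ := by
  rcases List.eq_nil_or_concat l₁ with rfl | ⟨A, a, rfl⟩
  · simp
  · rw [List.concat_eq_append] at h ⊢
    cases l₂ with
    | nil => simp
    | cons b B =>
      have := h a (by simp) b (by simp)
      rw [List.append_assoc, List.singleton_append, breaks_append_cons_cons, if_pos this]
      rfl

theorem breaks_append_le (l₁ l₂ : List V) :
    breaks G (l₁ ++ l₂) ≤ breaks G l₁ + breaks G l₂ + 1 := by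
  classical
  rcases List.eq_nil_or_concat l₁ with rfl | ⟨A, a, rfl⟩
  · simp
  · rw [List.concat_eq_append]
    cases l₂ with
    | nil => simp
    | cons b B =>
      rw [List.append_assoc, List.singleton_append, breaks_append_cons_cons]
      split_ifs <;> omega

theorem breaks_reverse (l : List V) : breaks G l.reverse = breaks G l := by
  classical
  induction l with
  | nil => rfl
  | cons a l ih =>
    cases l with
    | nil => rfl
    | cons b l =>
      have : (a :: b :: l).reverse = l.reverse ++ b :: a :: [] := by simp
      rw [this, breaks_append_cons_cons, ← List.reverse_cons, ih, breaks_cons_cons]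
      simp only [G.adj_comm a b, breaks_singleton]
      ring

theorem breaks_eq_zero_of_isChain {l : List V} (h : l.IsChain G.Adj) : breaks G l = 0 := by
  induction l with
  | nil => rfl
  | cons a l ih =>
    cases l with
    | nil => rfl
    | cons b l =>
      rw [List.isChain_cons_cons] at h
      rw [breaks_cons_cons, if_pos h.1, ih h.2]

theorem exists_break {l : List V} (h : 1 ≤ breaks G l) :
    ∃ A a b B, l = A ++ a :: b :: B ∧ ¬ G.Adj a b := by
  induction l with
  | nil => simp at h
  | cons a l ih =>
    cases l with
    | nil => simp at h
    | cons b l =>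
      by_cases hab : G.Adj a b
      · rw [breaks_cons_cons, if_pos hab, zero_add] at h
        obtain ⟨A, c, d, B, hl, hcd⟩ := ih h
        exact ⟨a :: A, c, d, B, by simp [hl], hcd⟩
      · exact ⟨[], a, b, l, rfl, hab⟩

theorem breaks_map {W : Type*} (H : SimpleGraph W) (f : G ≃g H) (l : List V) :
    breaks H (l.map f) = breaks G l := by
  induction l with
  | nil => rfl
  | cons a l ih =>
    cases l with
    | nil => rfl
    | cons b l =>
      have hab : H.Adj (f a) (f b) ↔ G.Adj a b := f.map_adj_iff
      simp only [List.map_cons, breaks_cons_cons] at ih ⊢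
      rw [ih]
      by_cases h : G.Adj a b
      · rw [if_pos h, if_pos (hab.2 h)]
      · rw [if_neg h, if_neg (hab.not.2 h)]

/-! ### Arrangements and path covers -/

/-- Cutting a list at its breaks yields chains of adjacent vertices. -/
theorem exists_flatten_eq (l : List V) (hl : l ≠ []) :
    ∃ L : List (List V), L.flatten = l ∧ (∀ p ∈ L, p ≠ [] ∧ p.IsChain G.Adj) ∧
      L.length = breaks G l + 1 := by
  induction l with
  | nil => exact absurd rfl hl
  | cons a l ih =>
    cases l with
    | nil => exact ⟨[[a]], by simp, by simp, by simp⟩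
    | cons b l =>
      obtain ⟨L, hL, hc, hlen⟩ := ih (by simp)
      by_cases hab : G.Adj a b
      · cases L with
        | nil => simp at hL
        | cons p L =>
          have hp := hc p (by simp)
          obtain ⟨c, p, rfl⟩ := List.exists_cons_of_ne_nil hp.1
          obtain ⟨rfl, -⟩ : c = b ∧ _ := by simpa using hL
          refine ⟨(a :: c :: p) :: L, by simpa using hL, ?_, ?_⟩
          · intro q hq
            rcases List.mem_cons.1 hq with rfl | hq
            · exact ⟨by simp, List.isChain_cons_cons.2 ⟨hab, hp.2⟩⟩
            · exact hc q (by simp [hq])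
          · simpa [breaks_cons_cons, hab] using hlen
      · refine ⟨[a] :: L, by simp [hL], ?_, ?_⟩
        · intro q hq
          rcases List.mem_cons.1 hq with rfl | hq
          · simp
          · exact hc q hq
        · simp [breaks_cons_cons, hab, hlen]; ring

theorem isPathCoverable_of_hasArrangement [Nonempty V] {k : ℕ} (h : HasArrangement G k) :
    IsPathCoverable G k := by
  obtain ⟨w, hnd, hall, hb⟩ := h
  have hw : w ≠ [] := List.ne_nil_of_mem (hall (Classical.arbitrary V))
  obtain ⟨L, rfl, hc, hlen⟩ := exists_flatten_eq G w hw
  rw [List.nodup_flatten] at hnd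
  refine ⟨L.length, by omega, fun i => L[i].head (hc _ (by simp)).1,
    fun i => L[i].getLast (hc _ (by simp)).1,
    fun i => SimpleGraph.Walk.ofSupport L[i] (hc _ (by simp)).1 (hc _ (by simp)).2, ?_, ?_, ?_⟩
  · intro i
    rw [SimpleGraph.Walk.isPath_def, SimpleGraph.Walk.support_ofSupport]
    exact hnd.1 _ (by simp)
  · intro i j hij
    simp only [SimpleGraph.Walk.support_ofSupport]
    have hp := List.pairwise_iff_getElem.1 hnd.2
    rcases lt_or_gt_of_ne (fun h => hij (Fin.ext h) : (i : ℕ) ≠ j) with h | h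
    · exact hp i j i.2 j.2 h
    · exact (hp j i j.2 i.2 h).symm
  · intro v
    obtain ⟨p, hp, hv⟩ := List.mem_flatten.1 (hall v)
    obtain ⟨i, hi, rfl⟩ := List.getElem_of_mem hp
    exact ⟨⟨i, hi⟩, by simpa using hv⟩

theorem breaks_flatten_lt (L : List (List V)) (hL : L ≠ []) (h : ∀ p ∈ L, p.IsChain G.Adj) :
    breaks G L.flatten < L.length := by
  induction L with
  | nil => exact absurd rfl hL
  | cons p L ih =>
    have hp := breaks_eq_zero_of_isChain G (h p (by simp))
    by_cases hL' : L = []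
    · subst hL'; simp [hp]
    · have h1 := ih hL' fun q hq => h q (by simp [hq])
      have h2 := breaks_append_le G p L.flatten
      simp only [List.flatten_cons, List.length_cons]
      omega

theorem IsPathCoverable.hasArrangement [Nonempty V] {k : ℕ} (h : IsPathCoverable G k) :
    HasArrangement G k := by
  obtain ⟨m, hm, a, b, p, hpath, hdisj, hall⟩ := h
  refine ⟨(List.ofFn fun i => (p i).support).flatten, ?_, ?_, ?_⟩
  · rw [List.nodup_flatten]
    refine ⟨?_, ?_⟩
    · intro l hl
      obtain ⟨i, rfl⟩ := (List.mem_ofFn' _ _).1 hl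
      exact (hpath i).support_nodup
    · rw [List.pairwise_ofFn]
      exact fun i j hij => hdisj i j hij.ne
  · intro v
    obtain ⟨i, hi⟩ := hall v
    exact List.mem_flatten.2 ⟨_, (List.mem_ofFn' _ _).2 ⟨i, rfl⟩, hi⟩
  · refine lt_of_lt_of_le (breaks_flatten_lt G _ ?_ ?_) (by simpa using hm)
    · obtain ⟨i, -⟩ := hall (Classical.arbitrary V)
      exact List.ne_nil_of_mem ((List.mem_ofFn' _ _).2 ⟨i, rfl⟩)
    · intro l hl
      obtain ⟨i, rfl⟩ := (List.mem_ofFn' _ _).1 hl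
      exact (p i).isChain_adj_support

/-! ### The degree condition at the ends of an optimal arrangement -/

/-- If the ends of a list are adjacent, the list can be rotated so that it begins after one of
its breaks, which removes that break. -/
theorem exists_perm_breaks_of_ends_adj {c : List V} {u x : V} (hu : c.getLast? = some u)
    (hx : c.head? = some x) (hux : G.Adj u x) (hb : 1 ≤ breaks G c) :
    ∃ c' : List V, c'.Perm c ∧ breaks G c' + 1 = breaks G c := by
  obtain ⟨A, a, b, B, rfl, hab⟩ := exists_break G hb
  refine ⟨(b :: B) ++ (A ++ [a]), ?_, ?_⟩
  · have : A ++ a :: b :: B = (A ++ [a]) ++ (b :: B) := by simp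
    rw [this]
    exact List.perm_append_comm
  · rw [breaks_append_of_adj, breaks_append_cons_cons, if_neg hab]
    · ring
    · intro p hp q hq
      have h1 : p = u := by
        have : (A ++ a :: b :: B).getLast? = (b :: B).getLast? := by
          rw [show A ++ a :: b :: B = (A ++ [a]) ++ (b :: B) by simp, List.getLast?_append]
          simp [List.getLast?_cons]
        rw [this] at hu
        rw [hu] at hp
        simpa using hp.symm
      have h2 : q = x := by
        cases A <;> simp_all
      rw [h1, h2]; exact hux

open Classical in
theorem countP_add_countP_add_breaks_le (u v : V) (w : List V) (hw : w ≠ [])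
    (h : ∀ P x y S, w = P ++ x :: y :: S →
      (if G.Adj u x then 1 else 0) + (if G.Adj v y then 1 else 0) +
        (if G.Adj x y then 0 else 1) ≤ 1) :
    w.dropLast.countP (fun x => G.Adj u x) + w.tail.countP (fun x => G.Adj v x) +
      breaks G w + 1 ≤ w.length := by
  induction w with
  | nil => exact absurd rfl hw
  | cons a l ih =>
    cases l with
    | nil => simp
    | cons b l =>
      have h1 := ih (by simp) fun P x y S hP => h (a :: P) x y S (by simp [hP])
      have h2 := h [] a b l rfl
      simp only [List.dropLast_cons_cons, List.tail_cons, List.countP_cons, breaks_cons_cons,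
        List.length_cons, decide_eq_true_eq] at h1 ⊢
      split_ifs at h2 ⊢ <;> omega

open Classical in
/-- The Ore-type degree condition: if no rearrangement of `w` has fewer breaks, and `w` has a
break, then its two ends `v` and `u` together have few neighbours in `w`. For two consecutive
entries `x`, `y` of `w`, at most one of the statements `u ~ x`, `v ~ y`, `x ≁ y` can hold:
otherwise reversing a segment of `w` removes a break, or closes `w` up to a cycle with as many
breaks, which can then be cut at one of them. -/
theorem countP_ends_le {w : List V} {u v : V} (hu : w.getLast? = some u)
    (hv : w.head? = some v) (hb : 1 ≤ breaks G w)
    (hmin : ∀ w' : List V, w'.Perm w → breaks G w ≤ breaks G w') :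
    w.countP (fun x => G.Adj u x) + w.countP (fun x => G.Adj v x) + breaks G w + 1
      ≤ w.length := by
  have hw : w ≠ [] := by rintro rfl; simp at hu
  have key := countP_add_countP_add_breaks_le G u v w hw ?_
  · have e1 : w.countP (fun x => G.Adj u x) = w.dropLast.countP (fun x => G.Adj u x) := by
      rw [List.getLast?_eq_some_iff] at hu
      obtain ⟨ys, rfl⟩ := hu
      simp
    have e2 : w.countP (fun x => G.Adj v x) = w.tail.countP (fun x => G.Adj v x) := by
      cases w with
      | nil => simp
      | cons a l =>
        obtain rfl : a = v := by simpa using hv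
        simp
    rw [e1, e2]; exact key
  · rintro P x y S rfl
    have hrev : (P ++ [x]).reverse.head? = some x := by simp
    have hrev' : (P ++ [x]).reverse.getLast? = some v := by
      rw [List.getLast?_reverse, ← hv]
      cases P <;> simp
    have hlast : (y :: S).getLast? = some u := by
      rw [← hu, show P ++ x :: y :: S = (P ++ [x]) ++ (y :: S) by simp, List.getLast?_append]
      simp [List.getLast?_cons]
    have hsplit := breaks_append_cons_cons G P x y S
    have hperm1 : ((P ++ [x]).reverse ++ (y :: S)).Perm (P ++ x :: y :: S) := by
      rw [show P ++ x :: y :: S = (P ++ [x]) ++ (y :: S) by simp]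
      exact (List.reverse_perm _).append_right _
    have hperm2 : ((P ++ [x]) ++ (y :: S).reverse).Perm (P ++ x :: y :: S) := by
      rw [show P ++ x :: y :: S = (P ++ [x]) ++ (y :: S) by simp]
      exact (List.reverse_perm _).append_left _
    have hvy : G.Adj v y → breaks G ((P ++ [x]).reverse ++ (y :: S)) =
        breaks G (P ++ [x]) + breaks G (y :: S) := fun h => by
      rw [breaks_append_of_adj, breaks_reverse]
      intro p hp q hq
      rw [hrev'] at hp
      obtain rfl : v = p := by simpa using hp
      obtain rfl : y = q := by simpa using hq
      exact h
    have hux : G.Adj u x → breaks G ((P ++ [x]) ++ (y :: S).reverse) =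
        breaks G (P ++ [x]) + breaks G (y :: S) := fun h => by
      rw [breaks_append_of_adj, breaks_reverse]
      intro p hp q hq
      rw [List.head?_reverse, hlast] at hq
      obtain rfl : x = p := by simpa using hp
      obtain rfl : u = q := by simpa using hq
      exact h.symm
    have hcross : ¬ (G.Adj u x ∧ G.Adj v y ∧ G.Adj x y) := by
      rintro ⟨h1, h2, h3⟩
      rw [if_pos h3] at hsplit
      have e := hvy h2
      obtain ⟨c', hc', hbc⟩ := exists_perm_breaks_of_ends_adj G
        (c := (P ++ [x]).reverse ++ (y :: S)) (u := u) (x := x)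
        (by rw [List.getLast?_append, hlast]; simp) (by simp) h1 (by omega)
      have := hmin c' (hc'.trans hperm1)
      omega
    have m1 := hmin _ hperm1
    have m2 := hmin _ hperm2
    split_ifs at hsplit ⊢ with h1 h2 h3 h3 <;> first
      | omega
      | (exfalso; tauto)
      | (exfalso; have := hvy ‹_›; omega)
      | (exfalso; have := hux ‹_›; omega)

/-- A vertex adjacent to all entries of a list can be inserted so that it repairs a break. -/
theorem exists_perm_cons_breaks_le {w : List V} {y : V} (hy : ∀ a ∈ w, G.Adj y a) :
    ∃ w' : List V, w'.Perm (y :: w) ∧ breaks G w' ≤ breaks G w - 1 := by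
  by_cases hb : 1 ≤ breaks G w
  · obtain ⟨A, a, b, B, rfl, hab⟩ := exists_break G hb
    refine ⟨A ++ a :: y :: b :: B, ?_, ?_⟩
    · rw [show A ++ a :: y :: b :: B = (A ++ [a]) ++ y :: b :: B by simp,
        show A ++ a :: b :: B = (A ++ [a]) ++ b :: B by simp]
      exact List.perm_middle
    · rw [breaks_append_cons_cons, breaks_append_cons_cons, breaks_cons_cons, if_neg hab,
        if_pos (hy a (by simp)).symm, if_pos (hy b (by simp))]
      omega
  · refine ⟨y :: w, List.Perm.refl _, ?_⟩
    cases w with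
    | nil => simp
    | cons b w => rw [breaks_cons_cons, if_pos (hy b (by simp))]; omega

theorem exists_perm_append_breaks_le (ys w : List V) (hys : ys.Pairwise G.Adj)
    (hyw : ∀ y ∈ ys, ∀ a ∈ w, G.Adj y a) :
    ∃ w' : List V, w'.Perm (ys ++ w) ∧ breaks G w' ≤ breaks G w - ys.length := by
  induction ys with
  | nil => exact ⟨w, List.Perm.refl _, by simp⟩
  | cons y ys ih =>
    rw [List.pairwise_cons] at hys
    obtain ⟨w₁, hp₁, hb₁⟩ := ih hys.2 fun z hz => hyw z (by simp [hz])
    obtain ⟨w₂, hp₂, hb₂⟩ := exists_perm_cons_breaks_le G (w := w₁) (y := y) fun a ha => by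
      rcases List.mem_append.1 (hp₁.mem_iff.1 ha) with h | h
      · exact hys.1 a h
      · exact hyw y (by simp) a h
    refine ⟨w₂, hp₂.trans (by simpa using hp₁.cons y), ?_⟩
    simp only [List.length_cons]
    omega

/-! ### A lower bound for the number of breaks -/

open Classical in
/-- Cut a list at its breaks and remove its `Y`-vertices. If all neighbours of `X` lie in `Y`, then
each piece left is a single vertex of `X` or lies outside `X`, which bounds the number of pieces from
below. The last summand corrects the number of pieces for a list that starts in `Y`. -/
theorem countP_le_countP_add_breaks (X Y : Set V)
    (hX : ∀ x ∈ X, ∀ v, G.Adj x v → v ∈ Y) (hXY : Disjoint X Y) (w : List V) (hw : w ≠ []) :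
    w.countP (fun v => v ∈ X) + (if ∃ z ∈ w, z ∉ X ∧ z ∉ Y then 1 else 0) ≤
      w.countP (fun v => v ∈ Y) + breaks G w +
        (if ∃ v ∈ w.head?, v ∉ Y then 1 else 0) := by
  rw [Set.disjoint_left] at hXY
  induction w with
  | nil => exact absurd rfl hw
  | cons a l ih =>
    cases l with
    | nil =>
      have := @hXY a
      by_cases h1 : a ∈ X <;> by_cases h2 : a ∈ Y <;> simp_all
    | cons b l =>
      specialize ih (by simp)
      simp only [List.countP_cons (a := a), breaks_cons_cons, List.head?_cons, Option.mem_some_iff,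
        exists_eq_left', decide_eq_true_eq, List.exists_mem_cons_iff (a := a)] at ih ⊢
      have hab : a ∈ X → G.Adj a b → b ∈ Y := fun h => hX a h b
      have hba : b ∈ X → G.Adj a b → a ∈ Y := fun h h' => hX b h a h'.symm
      have hb : b ∉ X → b ∉ Y → ∃ z ∈ b :: l, z ∉ X ∧ z ∉ Y := fun h h' => ⟨b, by simp, h, h'⟩
      have h1 := @hXY a
      have h2 := @hXY b
      generalize List.countP (fun v => decide (v ∈ X)) (b :: l) = n₁ at ih ⊢
      generalize List.countP (fun v => decide (v ∈ Y)) (b :: l) = n₂ at ih ⊢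
      generalize breaks G (b :: l) = n₃ at ih ⊢
      clear hX hXY hw
      by_cases hQ : ∃ z ∈ b :: l, z ∉ X ∧ z ∉ Y <;> by_cases haX : a ∈ X <;>
        by_cases haY : a ∈ Y <;> by_cases hbX : b ∈ X <;> by_cases hbY : b ∈ Y <;>
        by_cases hadj : G.Adj a b <;>
        simp only [hQ, haX, haY, hbX, hbY, hadj, not_true, not_false_iff, if_true, if_false,
          and_true, and_false, or_true, or_false, imp_false, true_imp_iff] at * <;>
        omega

end PathCover

namespace PathCover

variable {V : Type*}

/-! ### Edge-maximal graphs that are not coverable -/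

theorem exists_adj_of_breaks_lt {G H : SimpleGraph V} {l : List V}
    (h : breaks H l < breaks G l) :
    ∃ A a b B, l = A ++ a :: b :: B ∧ H.Adj a b ∧ ¬ G.Adj a b := by
  induction l with
  | nil => simp at h
  | cons a l ih =>
    cases l with
    | nil => simp at h
    | cons b l =>
      by_cases hab : H.Adj a b ∧ ¬ G.Adj a b
      · exact ⟨[], a, b, l, rfl, hab⟩
      · simp only [breaks_cons_cons] at h
        have hlt : breaks H (b :: l) < breaks G (b :: l) := by
          split_ifs at h <;> first | omega | (exfalso; tauto)
        obtain ⟨A, c, d, B, hl, hcd⟩ := ih hlt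
        exact ⟨a :: A, c, d, B, by simp [hl], hcd⟩

theorem countP_eq_card_filter [DecidableEq V] {w : List V} (hw : w.Nodup) (p : V → Prop)
    [DecidablePred p] : w.countP (fun v => p v) = {v ∈ w.toFinset | p v}.card := by
  rw [List.countP_eq_length_filter, ← List.toFinset_card_of_nodup (hw.filter _)]
  congr 1
  ext v
  simp

/-- Adding the edge `uv` to a graph without an arrangement can only help by joining two of
`k + 1` disjoint paths at their ends, so that the degree condition for optimal arrangements
applies to `u` and `v`. -/
theorem degree_add_degree_lt [Fintype V] (H : SimpleGraph V) [DecidableRel H.Adj] {k : ℕ}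
    (hk : 1 ≤ k) (hH : ¬ HasArrangement H k) {u v : V}
    (huv : HasArrangement (H ⊔ SimpleGraph.edge u v) k) :
    H.degree u + H.degree v + k + 1 ≤ Fintype.card V := by
  classical
  obtain ⟨w, hnd, hall, hb⟩ := huv
  set H' := H ⊔ SimpleGraph.edge u v with hH'
  have hmin : ∀ w' : List V, w'.Perm w → k ≤ breaks H w' := fun w' hp => by
    by_contra hlt
    exact hH ⟨w', hp.nodup_iff.2 hnd, fun x => hp.mem_iff.2 (hall x), not_le.1 hlt⟩
  have hends : ∀ {a b}, H'.Adj a b → ¬ H.Adj a b → (a = u ∧ b = v) ∨ (a = v ∧ b = u) := by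
    intro a b h1 h2
    rw [hH', SimpleGraph.sup_adj, SimpleGraph.edge_adj] at h1
    tauto
  obtain ⟨A, a, b, B, rfl, hab', hab⟩ := exists_adj_of_breaks_lt (hb.trans_le (hmin w (.refl _)))
  have hsplit : A ++ a :: b :: B = (A ++ [a]) ++ (b :: B) := by simp
  have hdis : List.Disjoint (A ++ [a]) (b :: B) := by
    rw [hsplit] at hnd; exact (List.nodup_append'.1 hnd).2.2
  have hE := hends hab' hab
  have h1 : breaks H (A ++ [a]) ≤ breaks H' (A ++ [a]) := by
    by_contra hlt
    obtain ⟨P, c, d, Q, hP, hc, hd⟩ := exists_adj_of_breaks_lt (not_le.1 hlt)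
    have hbm : b ∈ A ++ [a] := by
      rw [hP]
      rcases hE with ⟨rfl, rfl⟩ | ⟨rfl, rfl⟩ <;> rcases hends hc hd with ⟨rfl, rfl⟩ | ⟨rfl, rfl⟩ <;>
        simp
    exact hdis hbm (by simp)
  have h2 : breaks H (b :: B) ≤ breaks H' (b :: B) := by
    by_contra hlt
    obtain ⟨P, c, d, Q, hP, hc, hd⟩ := exists_adj_of_breaks_lt (not_le.1 hlt)
    have ham : a ∈ b :: B := by
      rw [hP]
      rcases hE with ⟨rfl, rfl⟩ | ⟨rfl, rfl⟩ <;> rcases hends hc hd with ⟨rfl, rfl⟩ | ⟨rfl, rfl⟩ <;>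
        simp
    exact hdis (by simp) ham
  have h3 := breaks_append_cons_cons H' A a b B
  rw [if_pos hab'] at h3
  have hp : ((b :: B) ++ (A ++ [a])).Perm (A ++ a :: b :: B) := by
    rw [hsplit]; exact List.perm_append_comm
  have h4 := breaks_append_le H (b :: B) (A ++ [a])
  have h5 := hmin _ hp
  have hcard : ∀ x, ((b :: B) ++ (A ++ [a])).countP (fun y => H.Adj x y) = H.degree x := by
    intro x
    rw [countP_eq_card_filter (hp.nodup_iff.2 hnd), ← SimpleGraph.card_neighborFinset_eq_degree]
    congr 1
    ext y
    have := hp.mem_iff.2 (hall y)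
    simp only [Finset.mem_filter, List.mem_toFinset, SimpleGraph.mem_neighborFinset]
    tauto
  have hlen : ((b :: B) ++ (A ++ [a])).length = Fintype.card V := by
    rw [← List.toFinset_card_of_nodup (hp.nodup_iff.2 hnd), ← Finset.card_univ]
    congr 1
    ext y
    simp only [List.mem_toFinset, Finset.mem_univ, iff_true]
    exact hp.mem_iff.2 (hall y)
  have key := countP_ends_le H (w := (b :: B) ++ (A ++ [a])) (u := a) (v := b)
    (by rw [← List.append_assoc, List.getLast?_append]; simp) (by simp) (by omega)
    (fun w' hw' => by have := hmin w' (hw'.trans hp); omega)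
  have e1 := hcard a
  have e2 := hcard b
  have hk' : breaks H ((b :: B) ++ (A ++ [a])) = k := by omega
  have : H.degree a + H.degree b = H.degree u + H.degree v := by
    rcases hE with ⟨rfl, rfl⟩ | ⟨rfl, rfl⟩
    · rfl
    · ring
  have f1 : ∀ x, List.countP (fun y => @decide (H.Adj x y) (Classical.propDecidable _))
      ((b :: B) ++ (A ++ [a])) = H.degree x := fun x => by
    rw [← hcard x]; congr!
  rw [hlen, hk', f1, f1] at key
  omega

/-! ### The structure of dense graphs that are not coverable -/

theorem pairwise_adj_of_forall_ne {G : SimpleGraph V} {l : List V} (hl : l.Nodup)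
    (h : ∀ a ∈ l, ∀ b ∈ l, a ≠ b → G.Adj a b) : l.Pairwise G.Adj :=
  List.Pairwise.imp_of_mem (fun ha hb hne => h _ ha _ hb hne) hl

/-- Let `L` induce a graph with minimum degree at least `δ - |Y|` on `δ + k` vertices, let
`1 ≤ |Y| < δ`, and let `Y` be a subset of the clique `Lᶜ` all of whose vertices are adjacent to all
of `L`. Then an optimal arrangement of `L` has at most `k + |Y| - 2` breaks; `|Y| - 1` of them can be
repaired by vertices of `Y`, and the last vertex of `Y` connects `L` to the rest of the clique. -/
theorem hasArrangement_of_clique_compl [Fintype V] [DecidableEq V] (H : SimpleGraph V)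
    [DecidableRel H.Adj] {k δ : ℕ} (hk : 1 ≤ k) {L Y : Finset V} (hL : L.card = δ + k)
    (hYL : Y ⊆ Lᶜ) (hY : Y.Nonempty) (hYδ : Y.card < δ)
    (hclique : ∀ u ∉ L, ∀ v ∉ L, u ≠ v → H.Adj u v) (hadj : ∀ y ∈ Y, ∀ v ∈ L, H.Adj y v)
    (hdeg : ∀ v ∈ L, δ ≤ {u ∈ L | H.Adj v u}.card + Y.card) : HasArrangement H k := by
  classical
  have hYL' : ∀ y ∈ Y, y ∉ L := fun y hy => Finset.mem_compl.1 (hYL hy)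
  obtain ⟨w, hwL, hmin⟩ : ∃ w : List V, w.Perm L.toList ∧
      ∀ w' : List V, w'.Perm w → breaks H w ≤ breaks H w' := by
    have hne : {w : List V | w.Perm L.toList}.Nonempty := ⟨L.toList, .refl _⟩
    obtain ⟨w, hw, hmin⟩ := (measure (breaks H)).wf.has_min _ hne
    exact ⟨w, hw, fun w' hw' => not_lt.1 (hmin w' (hw'.trans hw))⟩
  have hwnd : w.Nodup := hwL.nodup_iff.2 L.nodup_toList
  have hwmem : ∀ v, v ∈ w ↔ v ∈ L := fun v => by rw [hwL.mem_iff, Finset.mem_toList]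
  have hwlen : w.length = δ + k := by rw [hwL.length_eq, Finset.length_toList, hL]
  have hYpos : 1 ≤ Y.card := hY.card_pos
  have hcount : ∀ v, w.countP (fun x => H.Adj v x) = {u ∈ L | H.Adj v u}.card := by
    intro v
    rw [countP_eq_card_filter hwnd]
    congr 2
    ext x; simp [hwmem]
  have hbw : breaks H w + 2 ≤ Y.card + k := by
    by_cases hb : 1 ≤ breaks H w
    · have hw : w ≠ [] := by rintro rfl; simp at hb
      have key := countP_ends_le H (List.getLast?_eq_some_getLast hw)
        (List.head?_eq_some_head hw) hb hmin
      rw [hwlen] at key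
      have h1 := hdeg _ ((hwmem _).1 (List.getLast_mem hw))
      have h2 := hdeg _ ((hwmem _).1 (List.head_mem hw))
      rw [← hcount] at h1 h2
      have f1 : ∀ x, List.countP (fun y => @decide (H.Adj x y) (Classical.propDecidable _)) w =
          w.countP (fun y => H.Adj x y) := fun x => by congr!
      rw [f1, f1] at key
      omega
    · omega
  obtain ⟨y, hy⟩ := hY
  obtain ⟨w₁, hp₁, hb₁⟩ := exists_perm_append_breaks_le H (Y.erase y).toList w
    (pairwise_adj_of_forall_ne (Finset.nodup_toList _) (by
      intro a ha b hb hab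
      simp only [Finset.mem_toList, Finset.mem_erase] at ha hb
      exact hclique a (hYL' a ha.2) b (hYL' b hb.2) hab))
    (by
      intro a ha b hb
      simp only [Finset.mem_toList, Finset.mem_erase] at ha
      exact hadj a ha.2 b ((hwmem b).1 hb))
  have hw₁mem : ∀ v, v ∈ w₁ ↔ (v ≠ y ∧ v ∈ Y) ∨ v ∈ L := fun v => by
    rw [hp₁.mem_iff, List.mem_append, Finset.mem_toList, Finset.mem_erase, hwmem]
  have hw₁nd : w₁.Nodup := by
    rw [hp₁.nodup_iff, List.nodup_append']
    refine ⟨Finset.nodup_toList _, hwnd, ?_⟩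
    intro a ha hb
    simp only [Finset.mem_toList, Finset.mem_erase] at ha
    exact hYL' a ha.2 ((hwmem a).1 hb)
  have htail : ∀ v, v ∈ y :: (Lᶜ \ Y).toList ↔ v = y ∨ (v ∉ L ∧ v ∉ Y) := fun v => by simp
  have htailnd : (y :: (Lᶜ \ Y).toList).Nodup := by
    simp [Finset.nodup_toList, hy]
  refine ⟨w₁ ++ y :: (Lᶜ \ Y).toList, ?_, ?_, ?_⟩
  · rw [List.nodup_append']
    refine ⟨hw₁nd, htailnd, fun a ha hb => ?_⟩
    rw [hw₁mem] at ha
    rw [htail] at hb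
    have := hYL' y hy
    rcases hb with rfl | hb <;> tauto
  · intro v
    rw [List.mem_append, hw₁mem, htail]
    tauto
  · rw [breaks_append_of_adj, breaks_eq_zero_of_isChain H (l := y :: (Lᶜ \ Y).toList)]
    · rw [Finset.length_toList, Finset.card_erase_of_mem hy] at hb₁
      omega
    · refine (pairwise_adj_of_forall_ne htailnd fun a ha b hb hab => ?_).isChain
      have := hYL' y hy
      rw [htail] at ha hb
      refine hclique a ?_ b ?_ hab
      · rcases ha with rfl | ha <;> tauto
      · rcases hb with rfl | hb <;> tauto
    · intro a ha b hb
      obtain rfl : y = b := by simpa using hb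
      rcases (hw₁mem a).1 (List.mem_of_getLast? ha) with h | h
      · exact hclique a (hYL' a h.2) y (hYL' y hy) h.1
      · exact (hadj y hy a h).symm

/-- If all but few pairs of vertices are adjacent and non-adjacent vertices satisfy the degree
condition of an edge-maximal non-coverable graph, then the low degree vertices form an independent
set of `δ + k` vertices with a common neighbourhood of `δ` vertices. -/
theorem exists_independent_of_degree_add_degree_lt [Fintype V] [DecidableEq V] (H : SimpleGraph V)
    [DecidableRel H.Adj] {k δ t : ℕ} (hk : 1 ≤ k) (ht : t = δ + k)
    (hn : 8 * t * t + 7 * t < Fintype.card V)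
    (hconn : H.Connected) (hdeg : ∀ v, δ ≤ H.degree v)
    (hsum : (Fintype.card V - 1) * (Fintype.card V - 2 * t) ≤ ∑ v, H.degree v)
    (hH : ¬ HasArrangement H k)
    (hore : ∀ u v, u ≠ v → ¬ H.Adj u v → H.degree u + H.degree v + k + 1 ≤ Fintype.card V) :
    ∃ X Y : Finset V, Disjoint X Y ∧ X.card = t ∧ Y.card = δ ∧
      ∀ x ∈ X, H.neighborFinset x = Y := by
  classical
  set n := Fintype.card V with hndef
  have ht1 : 1 ≤ t := by omega
  have htt : t ≤ t * t := Nat.le_mul_self t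
  have hn8 : 8 * t + 7 * t < n := by nlinarith
  have hdlt : ∀ v, H.degree v < n := fun v => H.degree_lt_card_verts v
  have hcd : ∀ v, Hᶜ.degree v + H.degree v + 1 = n := fun v => by
    have := H.degree_compl v
    have := hdlt v
    omega
  have hcsum : ∑ v, Hᶜ.degree v ≤ 2 * t * (n - 1) := by
    have h1 : ∑ v, Hᶜ.degree v + ∑ v, H.degree v = n * (n - 1) := by
      rw [← Finset.sum_add_distrib, Finset.sum_congr rfl fun v _ => show _ = n - 1 by
        have := hcd v; omega]
      simp [hndef]
    obtain ⟨m, hm⟩ : ∃ m, n = m + 2 * t := ⟨n - 2 * t, by omega⟩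
    have h2 : n - 2 * t = m := by omega
    rw [h2] at hsum
    have h3 : n * (n - 1) = (n - 1) * m + 2 * t * (n - 1) :=
      calc n * (n - 1) = (m + 2 * t) * (n - 1) := by rw [← hm]
        _ = _ := by ring
    omega
  -- The vertices of small degree; by the degree condition the others form a clique.
  set L : Finset V := {v | 2 * H.degree v + k < n} with hLdef
  have hL : ∀ v, v ∈ L ↔ 2 * H.degree v + k < n := fun v => by simp [hLdef]
  have hclique : ∀ u ∉ L, ∀ v ∉ L, u ≠ v → H.Adj u v := by
    intro u hu v hv huv
    by_contra hadj
    have := hore u v huv hadj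
    rw [hL] at hu hv
    omega
  have hLcompl : Lᶜ.card = n - L.card := Finset.card_compl L
  have hLn : L.card ≤ n := Finset.card_le_univ L
  -- A crude bound first; it is what makes all vertices outside `L` adjacent to almost everything.
  have hL4 : L.card ≤ 4 * t := by
    by_contra hlt
    have h1 : L.card * n ≤ ∑ v ∈ L, 2 * Hᶜ.degree v := by
      rw [← smul_eq_mul]
      refine Finset.card_nsmul_le_sum _ _ _ fun v hv => ?_
      have := hcd v
      rw [hL] at hv
      omega
    have h2 : ∑ v ∈ L, 2 * Hᶜ.degree v ≤ 2 * ∑ v, Hᶜ.degree v := by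
      rw [← Finset.mul_sum]
      exact Nat.mul_le_mul_left _ (Finset.sum_le_univ_sum_of_nonneg fun _ => Nat.zero_le _)
    have h3 : (4 * t + 1) * n ≤ L.card * n := Nat.mul_le_mul_right _ (by omega)
    have h4 : 2 * t * (n - 1) ≤ 2 * t * n := Nat.mul_le_mul_left _ (by omega)
    have h5 : (4 * t + 1) * n = 2 * (2 * t * n) + n := by ring
    omega
  have hKdeg : ∀ v ∉ L, n ≤ H.degree v + L.card + 1 := by
    intro v hv
    have hsub : Lᶜ.erase v ⊆ H.neighborFinset v := by
      intro u hu
      simp only [Finset.mem_erase, Finset.mem_compl] at hu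
      rw [SimpleGraph.mem_neighborFinset]
      exact hclique v hv u hu.2 (Ne.symm hu.1)
    have := Finset.card_le_card hsub
    rw [Finset.card_erase_of_mem (by simpa using hv), SimpleGraph.card_neighborFinset_eq_degree]
      at this
    omega
  have hLdeg : ∀ v ∈ L, H.degree v + k ≤ L.card := by
    intro v hv
    obtain ⟨u, hu, huv⟩ : ∃ u ∉ L, ¬ H.Adj v u := by
      by_contra hcon
      push Not at hcon
      have hsub : Lᶜ ⊆ H.neighborFinset v := fun u hu => by
        rw [SimpleGraph.mem_neighborFinset]
        exact hcon u (Finset.mem_compl.1 hu)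
      have := Finset.card_le_card hsub
      rw [SimpleGraph.card_neighborFinset_eq_degree] at this
      rw [hL] at hv
      omega
    have h1 := hore v u (fun h => hu (h ▸ hv)) huv
    have h2 := hKdeg u hu
    omega
  -- Count the non-adjacent pairs between `L` and its complement from both sides.
  have hLt : L.card ≤ t := by
    have hdc := Finset.sum_card_bipartiteAbove_eq_sum_card_bipartiteBelow (s := L) (t := Lᶜ)
      Hᶜ.Adj
    have h1 : L.card * (n - 8 * t) ≤
        ∑ v ∈ L, (Finset.bipartiteAbove Hᶜ.Adj Lᶜ v).card := by
      rw [← smul_eq_mul]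
      refine Finset.card_nsmul_le_sum _ _ _ fun v hv => ?_
      have hsub : Lᶜ \ H.neighborFinset v ⊆ Finset.bipartiteAbove Hᶜ.Adj Lᶜ v := by
        intro u hu
        simp only [Finset.mem_sdiff, Finset.mem_compl, SimpleGraph.mem_neighborFinset] at hu
        simp only [Finset.mem_bipartiteAbove, Finset.mem_compl, SimpleGraph.compl_adj]
        exact ⟨hu.1, fun h => hu.1 (h ▸ hv), hu.2⟩
      have h2 := Finset.card_le_card hsub
      have h3 := Finset.le_card_sdiff (H.neighborFinset v) Lᶜ
      rw [SimpleGraph.card_neighborFinset_eq_degree] at h3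
      have := hLdeg v hv
      omega
    have h2 : ∑ v ∈ L, (Finset.bipartiteAbove Hᶜ.Adj Lᶜ v).card ≤ ∑ v ∈ L, Hᶜ.degree v := by
      refine Finset.sum_le_sum fun v _ => ?_
      rw [← SimpleGraph.card_neighborFinset_eq_degree]
      refine Finset.card_le_card fun u hu => ?_
      rw [SimpleGraph.mem_neighborFinset]
      exact (Finset.mem_bipartiteAbove _).1 hu |>.2
    have h3 : ∑ u ∈ Lᶜ, (Finset.bipartiteBelow Hᶜ.Adj L u).card ≤ ∑ u ∈ Lᶜ, Hᶜ.degree u := by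
      refine Finset.sum_le_sum fun v _ => ?_
      rw [← SimpleGraph.card_neighborFinset_eq_degree]
      refine Finset.card_le_card fun u hu => ?_
      rw [SimpleGraph.mem_neighborFinset]
      exact ((Finset.mem_bipartiteBelow _).1 hu |>.2).symm
    have h4 : ∑ v ∈ L, Hᶜ.degree v + ∑ u ∈ Lᶜ, Hᶜ.degree u = ∑ v, Hᶜ.degree v :=
      Finset.sum_add_sum_compl L _
    by_contra hlt
    have h5 : (t + 1) * (n - 8 * t) ≤ L.card * (n - 8 * t) := Nat.mul_le_mul_right _ (by omega)
    have h6 : (t + 1) * (n - 8 * t) ≤ t * (n - 1) := by nlinarith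
    zify [show 8 * t ≤ n by omega, show 1 ≤ n by omega] at h6 hn
    nlinarith
  have hLne : L.Nonempty := by
    rw [Finset.nonempty_iff_ne_empty]
    intro hempty
    refine hH ⟨Finset.univ.toList, Finset.nodup_toList _, fun v => by simp, ?_⟩
    rw [breaks_eq_zero_of_isChain]
    · exact hk
    · exact (pairwise_adj_of_forall_ne (Finset.nodup_toList _) fun a _ b _ hab =>
        hclique a (by simp [hempty]) b (by simp [hempty]) hab).isChain
  -- From here on the degree condition is sharp: it pins down `|L| = t` and the degree `δ` on `L`.
  obtain ⟨v₀, hv₀⟩ := hLne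
  have hLcard : L.card = t := by
    have := hLdeg v₀ hv₀
    have := hdeg v₀
    omega
  have hLdeg' : ∀ v ∈ L, H.degree v = δ := fun v hv => by
    have := hLdeg v hv
    have := hdeg v
    omega
  set Y : Finset V := {y ∈ Lᶜ | ∃ v ∈ L, H.Adj y v} with hYdef
  have hYmem : ∀ y, y ∈ Y ↔ y ∉ L ∧ ∃ v ∈ L, H.Adj y v := fun y => by simp [hYdef]
  have hYadj : ∀ y ∈ Y, ∀ v ∈ L, H.Adj y v := by
    intro y hy v hv
    rw [hYmem] at hy
    obtain ⟨hyL, u, hu, hyu⟩ := hy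
    by_contra hadj
    have hsub : insert u (Lᶜ.erase y) ⊆ H.neighborFinset y := by
      intro z hz
      rw [SimpleGraph.mem_neighborFinset]
      simp only [Finset.mem_insert, Finset.mem_erase, Finset.mem_compl] at hz
      rcases hz with rfl | hz
      · exact hyu
      · exact hclique y hyL z hz.2 (Ne.symm hz.1)
    have h1 := Finset.card_le_card hsub
    rw [Finset.card_insert_of_notMem (by simp [hu]), Finset.card_erase_of_mem (by simpa using hyL),
      SimpleGraph.card_neighborFinset_eq_degree] at h1
    have h2 := hore y v (fun h => hyL (h ▸ hv)) hadj
    have := hLdeg' v hv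
    omega
  have hYsub : ∀ v ∈ L, Y ⊆ H.neighborFinset v := fun v hv y hy => by
    rw [SimpleGraph.mem_neighborFinset]
    exact (hYadj y hy v hv).symm
  have hYL : Y ⊆ Lᶜ := Finset.filter_subset _ _
  have hYne : Y.Nonempty := by
    obtain ⟨u₀, hu₀⟩ : ∃ u, u ∉ L := by
      by_contra hcon
      push Not at hcon
      have : L = Finset.univ := Finset.eq_univ_iff_forall.2 hcon
      rw [this, Finset.card_univ] at hLcard
      omega
    obtain ⟨p⟩ := hconn.preconnected v₀ u₀
    obtain ⟨e, -, h1, h2⟩ := p.exists_boundary_dart (L : Set V) (by simpa using hv₀)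
      (by simpa using hu₀)
    exact ⟨e.snd, (hYmem _).2 ⟨by simpa using h2, e.fst, by simpa using h1, e.adj.symm⟩⟩
  have hYle : Y.card ≤ δ := by
    rw [← hLdeg' v₀ hv₀, ← SimpleGraph.card_neighborFinset_eq_degree]
    exact Finset.card_le_card (hYsub v₀ hv₀)
  have hYδ : Y.card = δ := by
    by_contra hne
    refine hH (hasArrangement_of_clique_compl H hk (hLcard.trans ht) hYL hYne (by omega) hclique
      hYadj fun v hv => ?_)
    rw [← hLdeg' v hv, ← SimpleGraph.card_neighborFinset_eq_degree]
    refine (Finset.card_le_card fun u hu => ?_).trans (Finset.card_union_le _ _)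
    rw [SimpleGraph.mem_neighborFinset] at hu
    by_cases huL : u ∈ L
    · simp [huL, hu]
    · exact Finset.mem_union_right _ ((hYmem u).2 ⟨huL, v, hv, hu.symm⟩)
  refine ⟨L, Y, ?_, hLcard, hYδ, fun v hv => ?_⟩
  · rw [Finset.disjoint_left]
    exact fun v hv hvY => ((hYmem v).1 hvY).1 hv
  · refine (Finset.eq_of_subset_of_card_le (hYsub v hv) ?_).symm
    rw [SimpleGraph.card_neighborFinset_eq_degree, hLdeg' v hv, hYδ]

/-- A dense connected graph without an arrangement is a spanning subgraph of
`K_δ ∨ (K_{n-2δ-k} ∪ (δ+k)K₁)` that contains all edges between the first and the last part. -/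
theorem exists_independent_of_not_hasArrangement [Fintype V] [DecidableEq V] (G : SimpleGraph V)
    [DecidableRel G.Adj] {k δ t : ℕ} (hk : 1 ≤ k) (ht : t = δ + k)
    (hn : 8 * t * t + 7 * t < Fintype.card V)
    (hconn : G.Connected) (hdeg : ∀ v, δ ≤ G.degree v)
    (hsum : (Fintype.card V - 1) * (Fintype.card V - 2 * t) ≤ ∑ v, G.degree v)
    (hG : ¬ HasArrangement G k) :
    ∃ X Y : Finset V, Disjoint X Y ∧ X.card = t ∧ Y.card = δ ∧
      ∀ x ∈ X, ∀ v, G.Adj x v ↔ v ∈ Y := by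
  classical
  obtain ⟨H, hGH, hmax⟩ := (Set.toFinite
    {H : SimpleGraph V | ¬ HasArrangement H k}).exists_le_maximal hG
  have hdGH : ∀ v, G.degree v ≤ H.degree v := fun v => SimpleGraph.degree_le_of_le hGH
  obtain ⟨X, Y, hXY, hX, hY, hnbr⟩ := exists_independent_of_degree_add_degree_lt H hk ht hn
    (hconn.mono hGH) (fun v => (hdeg v).trans (hdGH v))
    (hsum.trans (Finset.sum_le_sum fun v _ => hdGH v)) hmax.prop (fun u v huv hadj => by
      refine degree_add_degree_lt H hk hmax.prop ?_
      by_contra hcon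
      have hle := hmax.le_of_ge (y := H ⊔ SimpleGraph.edge u v) hcon le_sup_left
      exact hadj (hle (by
        rw [SimpleGraph.sup_adj, SimpleGraph.edge_adj]
        exact Or.inr ⟨by simp, huv⟩)))
  refine ⟨X, Y, hXY, hX, hY, fun x hx v => ?_⟩
  have hsub : G.neighborFinset x ⊆ Y := by
    rw [← hnbr x hx]
    intro v hv
    rw [SimpleGraph.mem_neighborFinset] at hv ⊢
    exact hGH hv
  rw [← SimpleGraph.mem_neighborFinset, Finset.eq_of_subset_of_card_le hsub]
  rw [hY, SimpleGraph.card_neighborFinset_eq_degree]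
  exact hdeg x

/-! ### The signless Laplacian index and the number of edges -/

theorem exists_eigenvector_qIndex [Fintype V] [DecidableEq V] [Nonempty V]
    (G : SimpleGraph V) [DecidableRel G.Adj] :
    ∃ x : V → ℝ, x ≠ 0 ∧ ∀ v, G.degree v * x v + ∑ u ∈ G.neighborFinset v, x u =
      qIndex G * x v := by
  obtain ⟨x, hx⟩ := (isGreatest_qIndex G).1.exists_hasEigenvector
  refine ⟨x, hx.2, fun v => ?_⟩
  have h := congrFun hx.apply_eq_smul v
  rw [Matrix.toLin'_apply, signlessLaplacian, Matrix.add_mulVec, Pi.add_apply,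
    SimpleGraph.adjMatrix_mulVec_apply, SimpleGraph.degMatrix, Matrix.mulVec_diagonal] at h
  simpa using h

/-- At a vertex `u` that maximizes `|x u| / deg u` for an eigenvector `x`, the eigenvalue equation
bounds the index by `deg u + (∑_{v ~ u} deg v) / deg u`. -/
theorem exists_qIndex_mul_degree_le [Fintype V] [DecidableEq V] [Nonempty V]
    (G : SimpleGraph V) [DecidableRel G.Adj]
    (hdeg : ∀ v, 1 ≤ G.degree v) :
    ∃ u, qIndex G * G.degree u ≤ (G.degree u : ℝ) ^ 2 + ∑ v ∈ G.neighborFinset u,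
      (G.degree v : ℝ) := by
  obtain ⟨x, hx0, hx⟩ := exists_eigenvector_qIndex G
  have hd : ∀ v, (0 : ℝ) < G.degree v := fun v => by exact_mod_cast hdeg v
  obtain ⟨u, -, hu⟩ := Finset.exists_max_image Finset.univ (fun v => |x v| / G.degree v)
    Finset.univ_nonempty
  set M := |x u| / G.degree u with hM
  have hle : ∀ v, |x v| ≤ M * G.degree v := fun v =>
    (div_le_iff₀ (hd v)).1 (hu v (Finset.mem_univ v))
  have hxu : |x u| = M * G.degree u := (div_mul_cancel₀ _ (hd u).ne').symm
  have hMpos : 0 < M := by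
    obtain ⟨v, hv⟩ := Function.ne_iff.1 hx0
    have h1 : 0 < |x v| := abs_pos.2 hv
    by_contra hcon
    have := mul_nonpos_of_nonpos_of_nonneg (not_lt.1 hcon) (hd v).le
    linarith [hle v]
  refine ⟨u, ?_⟩
  have h1 : qIndex G * |x u| ≤ G.degree u * |x u| + ∑ v ∈ G.neighborFinset u, |x v| := by
    calc qIndex G * |x u| ≤ |qIndex G * x u| := by
          rw [abs_mul]; exact mul_le_mul_of_nonneg_right (le_abs_self _) (abs_nonneg _)
      _ = |G.degree u * x u + ∑ v ∈ G.neighborFinset u, x v| := by rw [hx u]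
      _ ≤ |G.degree u * x u| + |∑ v ∈ G.neighborFinset u, x v| := abs_add_le _ _
      _ ≤ _ := by
          rw [abs_mul, Nat.abs_cast]
          gcongr
          exact Finset.abs_sum_le_sum_abs _ _
  have h2 : ∑ v ∈ G.neighborFinset u, |x v| ≤ M * ∑ v ∈ G.neighborFinset u, (G.degree v : ℝ) := by
    rw [Finset.mul_sum]
    exact Finset.sum_le_sum fun v _ => hle v
  rw [hxu] at h1
  refine le_of_mul_le_mul_left ?_ hMpos
  linarith

/-- A large index forces many edges: `2 |E| ≥ (n - 1) (n - 2 t)` if `q(G) ≥ 2 (n - t - 1)`. -/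
theorem le_sum_degree_of_le_qIndex [Fintype V] [DecidableEq V] [Nonempty V]
    (G : SimpleGraph V) [DecidableRel G.Adj] {t : ℕ}
    (ht : 2 * t + 1 < Fintype.card V) (hdeg : ∀ v, 1 ≤ G.degree v)
    (hq : 2 * ((Fintype.card V : ℝ) - t - 1) ≤ qIndex G) :
    (Fintype.card V - 1) * (Fintype.card V - 2 * t) ≤ ∑ v, G.degree v := by
  obtain ⟨u, hu⟩ := exists_qIndex_mul_degree_le G hdeg
  set n := Fintype.card V with hn
  have hdlt : ∀ v, G.degree v + 1 ≤ n := fun v => G.degree_lt_card_verts v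
  have hd1 : (1 : ℝ) ≤ G.degree u := by exact_mod_cast hdeg u
  have hdn : (G.degree u : ℝ) + 1 ≤ n := by exact_mod_cast hdlt u
  have h1 : ∑ v ∈ G.neighborFinset u, (G.degree v : ℝ) ≤ G.degree u * (n - 1) := by
    have : ∑ v ∈ G.neighborFinset u, (G.degree v : ℝ) ≤ ∑ v ∈ G.neighborFinset u, ((n : ℝ) - 1) :=
      Finset.sum_le_sum fun v _ => by
        have : (G.degree v : ℝ) + 1 ≤ n := by exact_mod_cast hdlt v
        linarith
    simpa [mul_sub] using this
  -- Every vertex outside the neighbourhood of `u` has degree at least one.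
  have h2 : ∑ v ∈ G.neighborFinset u, G.degree v + (n - 1) ≤ ∑ v, G.degree v := by
    rw [← Finset.sum_add_sum_compl (G.neighborFinset u)]
    have hmem : u ∈ (G.neighborFinset u)ᶜ := by simp
    rw [← Finset.add_sum_erase _ _ hmem]
    have h3 : ((G.neighborFinset u)ᶜ.erase u).card ≤
        ∑ v ∈ (G.neighborFinset u)ᶜ.erase u, G.degree v := by
      rw [Finset.card_eq_sum_ones]
      exact Finset.sum_le_sum fun v _ => hdeg v
    rw [Finset.card_erase_of_mem hmem, Finset.card_compl,
      SimpleGraph.card_neighborFinset_eq_degree] at h3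
    have := hdlt u
    omega
  have h2' : ∑ v ∈ G.neighborFinset u, (G.degree v : ℝ) + (n - 1) ≤ ∑ v, (G.degree v : ℝ) := by
    have : ((∑ v ∈ G.neighborFinset u, G.degree v + (n - 1) : ℕ) : ℝ) ≤
        ((∑ v, G.degree v : ℕ) : ℝ) := by exact_mod_cast h2
    rw [Nat.cast_add, Nat.cast_sub (by omega)] at this
    simpa using this
  have hqd : 2 * ((n : ℝ) - t - 1) * G.degree u ≤ qIndex G * G.degree u :=
    mul_le_mul_of_nonneg_right hq (by linarith)
  have hdlow : (n : ℝ) - 2 * t - 1 ≤ G.degree u := by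
    by_contra hcon
    nlinarith
  have hreal : ((n : ℝ) - 1) * (n - 2 * t) ≤ ∑ v, (G.degree v : ℝ) := by
    nlinarith [mul_nonneg (sub_nonneg.2 hdlow) (sub_nonneg.2 hdn)]
  have hcast : (((n - 1) * (n - 2 * t) : ℕ) : ℝ) ≤ ((∑ v, G.degree v : ℕ) : ℝ) := by
    rw [Nat.cast_mul, Nat.cast_sub (by omega), Nat.cast_sub (by omega)]
    simpa using hreal
  exact_mod_cast hcast

/-! ### The index after deletion of clique edges -/

theorem sum_sum_adj_sq_eq [Fintype V] (G : SimpleGraph V) [DecidableRel G.Adj] {x : V → ℝ} {q : ℝ}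
    (hx : ∀ v, G.degree v * x v + ∑ u ∈ G.neighborFinset v, x u = q * x v) :
    ∑ v, ∑ u, (if G.Adj v u then (x v + x u) ^ 2 else 0) = 2 * q * ∑ v, x v ^ 2 := by
  have h1 : ∀ v, ∑ u, (if G.Adj v u then x v ^ 2 else 0) = G.degree v * x v ^ 2 := fun v => by
    rw [← Finset.sum_filter, ← SimpleGraph.neighborFinset_eq_filter, Finset.sum_const,
      SimpleGraph.card_neighborFinset_eq_degree, nsmul_eq_mul]
  have h2 : ∀ v, ∑ u, (if G.Adj v u then x v * x u else 0) =
      x v * ∑ u ∈ G.neighborFinset v, x u := fun v => by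
    rw [← Finset.sum_filter, ← SimpleGraph.neighborFinset_eq_filter, Finset.mul_sum]
  have h3 : ∑ v, ∑ u, (if G.Adj v u then x u ^ 2 else 0) = ∑ v, G.degree v * x v ^ 2 := by
    rw [Finset.sum_comm]
    refine Finset.sum_congr rfl fun v _ => ?_
    rw [← h1 v]
    exact Finset.sum_congr rfl fun u _ => by simp only [G.adj_comm]
  have h4 : ∀ v u, (if G.Adj v u then (x v + x u) ^ 2 else 0) =
      (if G.Adj v u then x v ^ 2 else 0) + 2 * (if G.Adj v u then x v * x u else 0) +
        (if G.Adj v u then x u ^ 2 else 0) := fun v u => by split_ifs <;> ring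
  simp only [h4, Finset.sum_add_distrib, ← Finset.mul_sum, h3, h1, h2]
  rw [Finset.mul_sum, Finset.mul_sum, ← Finset.sum_add_distrib, ← Finset.sum_add_distrib]
  exact Finset.sum_congr rfl fun v _ => by linear_combination 2 * x v * hx v

/-- The Rayleigh quotient bound. Here `X` is an independent set with all neighbours in `Y`, and `F`
is a graph of non-edges of `G` outside `X`. The form `N ∑ x² - (∑ x)²` is what the clique on the
`N` vertices outside `X` misses to the form `2 (N - 1) ∑ x²`. -/
theorem rayleigh_le [Fintype V] [DecidableEq V] (G F : SimpleGraph V) [DecidableRel G.Adj]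
    [DecidableRel F.Adj]
    {X Y : Finset V} (hXY : Disjoint X Y) (hX : ∀ x ∈ X, ∀ v, G.Adj x v → v ∈ Y)
    (hF : ∀ u v, F.Adj u v → u ∉ X ∧ v ∉ X ∧ ¬ G.Adj u v) {x : V → ℝ} {q : ℝ}
    (hx : ∀ v, G.degree v * x v + ∑ u ∈ G.neighborFinset v, x u = q * x v)
    (hq : 2 * ((Xᶜ.card : ℝ) - 1) ≤ q) :
    2 * ((Xᶜ.card : ℝ) - 1) * ∑ v ∈ X, x v ^ 2 + Xᶜ.card * ∑ v ∈ Xᶜ, x v ^ 2 -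
        (∑ v ∈ Xᶜ, x v) ^ 2 + (∑ v, ∑ u, if F.Adj v u then (x v + x u) ^ 2 else 0) / 2 ≤
      ∑ v ∈ X, ∑ u ∈ Y, (x v + x u) ^ 2 := by
  have h0 := sum_sum_adj_sq_eq G hx
  have hYX : ∀ u ∈ Y, u ∉ X := fun u hu hu' => Finset.disjoint_left.1 hXY hu' hu
  have hA : ∀ v ∈ X, ∑ u, (if G.Adj v u then (x v + x u) ^ 2 else 0) ≤
      ∑ u ∈ Y, (x v + x u) ^ 2 := by
    intro v hv
    rw [← Finset.sum_filter]
    refine Finset.sum_le_sum_of_subset_of_nonneg (fun u hu => ?_) fun _ _ _ => sq_nonneg _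
    exact hX v hv u (Finset.mem_filter.1 hu).2
  have hB : ∑ v ∈ Xᶜ, ∑ u ∈ X, (if G.Adj v u then (x v + x u) ^ 2 else 0) ≤
      ∑ v ∈ X, ∑ u ∈ Y, (x v + x u) ^ 2 := by
    rw [Finset.sum_comm]
    refine Finset.sum_le_sum fun v hv => ?_
    rw [← Finset.sum_filter]
    have : ∀ u, (x u + x v) ^ 2 = (x v + x u) ^ 2 := fun u => by ring
    simp only [this]
    refine Finset.sum_le_sum_of_subset_of_nonneg (fun u hu => ?_) fun _ _ _ => sq_nonneg _
    exact hX v hv u (Finset.mem_filter.1 hu).2.symm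
  have hC : ∑ v ∈ Xᶜ, ∑ u ∈ Xᶜ, (if G.Adj v u then (x v + x u) ^ 2 else 0) ≤
      ∑ v ∈ Xᶜ, ∑ u ∈ Xᶜ, ((x v + x u) ^ 2 - (if v = u then 4 * x v ^ 2 else 0) -
        (if F.Adj v u then (x v + x u) ^ 2 else 0)) := by
    refine Finset.sum_le_sum fun v hv => Finset.sum_le_sum fun u hu => ?_
    have hFG := hF v u
    have hsq := sq_nonneg (x v + x u)
    by_cases hvu : v = u
    · subst hvu
      simp; nlinarith
    · by_cases hf : F.Adj v u
      · simp [hvu, hf, (hFG hf).2.2]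
      · simp only [hvu, hf, if_false, sub_zero]
        split_ifs <;> linarith
  have hD : ∑ v ∈ Xᶜ, ∑ u ∈ Xᶜ, ((x v + x u) ^ 2 - (if v = u then 4 * x v ^ 2 else 0) -
        (if F.Adj v u then (x v + x u) ^ 2 else 0)) =
      2 * Xᶜ.card * ∑ v ∈ Xᶜ, x v ^ 2 + 2 * (∑ v ∈ Xᶜ, x v) ^ 2 - 4 * ∑ v ∈ Xᶜ, x v ^ 2 -
        ∑ v, ∑ u, (if F.Adj v u then (x v + x u) ^ 2 else 0) := by
    have e1 : ∑ v, ∑ u, (if F.Adj v u then (x v + x u) ^ 2 else 0) =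
        ∑ v ∈ Xᶜ, ∑ u ∈ Xᶜ, (if F.Adj v u then (x v + x u) ^ 2 else 0) := by
      rw [← Finset.sum_subset (Finset.subset_univ Xᶜ)]
      · refine Finset.sum_congr rfl fun v _ => (Finset.sum_subset (Finset.subset_univ Xᶜ) ?_).symm
        intro u _ hu
        rw [if_neg fun h => hu (Finset.mem_compl.2 (hF v u h).2.1)]
      · intro v _ hv
        exact Finset.sum_eq_zero fun u _ => if_neg fun h => hv (Finset.mem_compl.2 (hF v u h).1)
    have e2 : ∑ v ∈ Xᶜ, ∑ u ∈ Xᶜ, (if v = u then 4 * x v ^ 2 else 0) = 4 * ∑ v ∈ Xᶜ, x v ^ 2 := by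
      rw [Finset.mul_sum]
      refine Finset.sum_congr rfl fun v hv => ?_
      rw [Finset.sum_ite_eq, if_pos hv]
    have e3 : ∑ v ∈ Xᶜ, ∑ u ∈ Xᶜ, (x v + x u) ^ 2 =
        2 * Xᶜ.card * ∑ v ∈ Xᶜ, x v ^ 2 + 2 * (∑ v ∈ Xᶜ, x v) ^ 2 := by
      have : ∀ v u, (x v + x u) ^ 2 = x v ^ 2 + 2 * (x v * x u) + x u ^ 2 := fun v u => by ring
      simp only [this, Finset.sum_add_distrib, ← Finset.mul_sum, Finset.sum_const, nsmul_eq_mul,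
        ← Finset.sum_mul]
      ring
    rw [e1]
    simp only [Finset.sum_sub_distrib]
    rw [e2, e3]
  have hsplit : ∑ v, ∑ u, (if G.Adj v u then (x v + x u) ^ 2 else 0) =
      ∑ v ∈ X, ∑ u, (if G.Adj v u then (x v + x u) ^ 2 else 0) +
        (∑ v ∈ Xᶜ, ∑ u ∈ X, (if G.Adj v u then (x v + x u) ^ 2 else 0) +
          ∑ v ∈ Xᶜ, ∑ u ∈ Xᶜ, (if G.Adj v u then (x v + x u) ^ 2 else 0)) := by
    rw [← Finset.sum_add_sum_compl X, ← Finset.sum_add_distrib]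
    congr 1
    exact Finset.sum_congr rfl fun v _ => (Finset.sum_add_sum_compl X _).symm
  have hA' := Finset.sum_le_sum hA
  have hsq : ∑ v, x v ^ 2 = ∑ v ∈ X, x v ^ 2 + ∑ v ∈ Xᶜ, x v ^ 2 :=
    (Finset.sum_add_sum_compl X _).symm
  have hpos : 0 ≤ ∑ v, x v ^ 2 := Finset.sum_nonneg fun _ _ => sq_nonneg _
  have hqs := mul_le_mul_of_nonneg_right hq hpos
  rw [hsq] at hqs h0
  linarith

/-- Completing the square in the coordinates on the independent set `X`. -/
theorem sum_sum_add_sq_le (X Y : Finset V) (x : V → ℝ) {l : ℝ} (hl : (Y.card : ℝ) < l) :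
    ∑ v ∈ X, ∑ u ∈ Y, (x v + x u) ^ 2 ≤
      l * ∑ v ∈ X, x v ^ 2 + X.card * (1 + Y.card / (l - Y.card)) * ∑ u ∈ Y, x u ^ 2 := by
  have hg : 0 < l - Y.card := sub_pos.2 hl
  have hcs : (∑ u ∈ Y, x u) ^ 2 ≤ Y.card * ∑ u ∈ Y, x u ^ 2 := sq_sum_le_card_mul_sum_sq
  rw [Finset.mul_sum, mul_assoc, ← nsmul_eq_mul, ← Finset.sum_const, ← Finset.sum_add_distrib]
  refine Finset.sum_le_sum fun v _ => ?_
  have h1 : ∑ u ∈ Y, (x v + x u) ^ 2 =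
      Y.card * x v ^ 2 + 2 * x v * ∑ u ∈ Y, x u + ∑ u ∈ Y, x u ^ 2 := by
    have : ∀ u, (x v + x u) ^ 2 = x v ^ 2 + 2 * x v * x u + x u ^ 2 := fun u => by ring
    simp only [this, Finset.sum_add_distrib, ← Finset.mul_sum, Finset.sum_const, nsmul_eq_mul]
  rw [h1]
  have h2 : 2 * x v * ∑ u ∈ Y, x u ≤ (l - Y.card) * x v ^ 2 +
      (∑ u ∈ Y, x u) ^ 2 / (l - Y.card) := by
    have e : (l - Y.card) * x v ^ 2 + (∑ u ∈ Y, x u) ^ 2 / (l - Y.card) - 2 * x v * ∑ u ∈ Y, x u =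
        ((l - Y.card) * x v - ∑ u ∈ Y, x u) ^ 2 / (l - Y.card) := by
      field_simp; ring
    have := div_nonneg (sq_nonneg ((l - Y.card) * x v - ∑ u ∈ Y, x u)) hg.le
    linarith
  have h3 : (∑ u ∈ Y, x u) ^ 2 / (l - Y.card) ≤
      Y.card / (l - Y.card) * ∑ u ∈ Y, x u ^ 2 := by
    rw [div_mul_eq_mul_div]
    exact div_le_div_of_nonneg_right hcs hg.le
  linarith

/-- Write a vector with sum `N` on the `N` vertices outside `X` as `1 + b`. To first order, each
edge of `F` contributes `4` to the form; the linear terms in `b` are absorbed into `N ∑ b²`. -/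
theorem quadratic_form_bound [Fintype V] [DecidableEq V] (F : SimpleGraph V) [DecidableRel F.Adj]
    {W Y : Finset V} (hYW : Y ⊆ W) (hF : ∀ u v, F.Adj u v → u ∈ W) {x : V → ℝ} {c : ℝ}
    (hc : 0 ≤ c) (hcW : c < W.card) (hsum : ∑ v ∈ W, x v = W.card)
    (h : W.card * ∑ v ∈ W, x v ^ 2 - (∑ v ∈ W, x v) ^ 2 +
      (∑ v, ∑ u, if F.Adj v u then (x v + x u) ^ 2 else 0) / 2 ≤ c * ∑ u ∈ Y, x u ^ 2) :
    (W.card - c) * (4 * F.edgeFinset.card - c * Y.card) ≤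
      8 * (F.edgeFinset.card : ℝ) ^ 2 + c ^ 2 * Y.card := by
  set N : ℝ := (W.card : ℝ) with hN
  set f : ℝ := (F.edgeFinset.card : ℝ) with hf
  have hM : 0 < N - c := sub_pos.2 hcW
  obtain ⟨b, hb⟩ : ∃ b : V → ℝ, ∀ v, x v = 1 + b v := ⟨fun v => x v - 1, fun v => by ring⟩
  have hb0 : ∑ v ∈ W, b v = 0 := by
    have : ∑ v ∈ W, x v = N + ∑ v ∈ W, b v := by
      simp only [hb, Finset.sum_add_distrib, Finset.sum_const, nsmul_eq_mul, mul_one, hN]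
    linarith
  have hb2 : ∑ v ∈ W, x v ^ 2 = N + ∑ v ∈ W, b v ^ 2 := by
    have : ∀ v, x v ^ 2 = 1 + 2 * b v + b v ^ 2 := fun v => by rw [hb]; ring
    simp only [this, Finset.sum_add_distrib, ← Finset.mul_sum, hb0, Finset.sum_const, nsmul_eq_mul,
      mul_one, mul_zero, add_zero, hN]
  have hdegF : ∑ v, (F.degree v : ℝ) = 2 * f := by
    have := F.sum_degrees_eq_twice_card_edges
    rw [hf]; exact_mod_cast this
  have hdeg0 : ∀ v ∉ W, F.degree v = 0 := fun v hv => by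
    rw [← SimpleGraph.card_neighborFinset_eq_degree, Finset.card_eq_zero,
      Finset.eq_empty_iff_forall_notMem]
    intro u hu
    exact hv (hF v u ((SimpleGraph.mem_neighborFinset _ _ _).1 hu))
  have hFsum : 8 * f + 8 * ∑ v ∈ W, F.degree v * b v ≤
      ∑ v, ∑ u, (if F.Adj v u then (x v + x u) ^ 2 else 0) := by
    have h1 : ∀ v u, (if F.Adj v u then 4 + 4 * b v + 4 * b u else 0) ≤
        (if F.Adj v u then (x v + x u) ^ 2 else 0) := fun v u => by
      split_ifs
      · rw [hb, hb]; nlinarith [sq_nonneg (b v + b u)]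
      · exact le_rfl
    refine le_trans (le_of_eq ?_) (Finset.sum_le_sum fun v _ => Finset.sum_le_sum fun u _ => h1 v u)
    have h2 : ∀ v u, (if F.Adj v u then 4 + 4 * b v + 4 * b u else 0) =
        (if F.Adj v u then 4 + 4 * b v else 0) + (if F.Adj v u then 4 * b u else 0) := fun v u => by
      split_ifs <;> ring
    have h3 : ∀ v, ∑ u, (if F.Adj v u then 4 + 4 * b v else 0) =
        4 * F.degree v + 4 * (F.degree v * b v) := fun v => by
      rw [← Finset.sum_filter, ← SimpleGraph.neighborFinset_eq_filter, Finset.sum_const,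
        SimpleGraph.card_neighborFinset_eq_degree, nsmul_eq_mul]
      ring
    have h4 : ∑ v, ∑ u, (if F.Adj v u then 4 * b u else 0) = ∑ v, 4 * (F.degree v * b v) := by
      rw [Finset.sum_comm]
      refine Finset.sum_congr rfl fun v _ => ?_
      simp only [F.adj_comm _ v]
      rw [← Finset.sum_filter, ← SimpleGraph.neighborFinset_eq_filter, Finset.sum_const,
        SimpleGraph.card_neighborFinset_eq_degree, nsmul_eq_mul]
      ring
    have h5 : ∑ v ∈ W, F.degree v * b v = ∑ v, F.degree v * b v :=
      Finset.sum_subset (Finset.subset_univ _) fun v _ hv => by simp [hdeg0 v hv]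
    simp only [h2, Finset.sum_add_distrib, h3, h4, h5, ← Finset.mul_sum, hdegF]
    ring
  have hY : c * ∑ u ∈ Y, x u ^ 2 =
      c * Y.card + ∑ v ∈ W, (if v ∈ Y then c * (2 * b v + b v ^ 2) else 0) := by
    rw [← Finset.sum_filter, Finset.filter_mem_eq_inter, Finset.inter_eq_right.2 hYW,
      ← Finset.mul_sum, ← mul_add]
    congr 1
    have : ∀ v, x v ^ 2 = 1 + (2 * b v + b v ^ 2) := fun v => by rw [hb]; ring
    simp only [this, Finset.sum_add_distrib, Finset.sum_const, nsmul_eq_mul, mul_one]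
  have hmain : 4 * f - c * Y.card ≤ ∑ v ∈ W, ((if v ∈ Y then c * (2 * b v + b v ^ 2) else 0) -
      N * b v ^ 2 - 4 * (F.degree v * b v)) := by
    rw [Finset.sum_sub_distrib, Finset.sum_sub_distrib, ← Finset.mul_sum, ← Finset.mul_sum]
    rw [hsum, hb2, hY] at h
    linarith
  have hpt : ∀ v ∈ W, (N - c) * ((if v ∈ Y then c * (2 * b v + b v ^ 2) else 0) -
      N * b v ^ 2 - 4 * (F.degree v * b v)) ≤
      4 * (F.degree v : ℝ) ^ 2 + (if v ∈ Y then c ^ 2 else 0) := by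
    intro v _
    have hd : (0 : ℝ) ≤ F.degree v := Nat.cast_nonneg _
    split_ifs
    · nlinarith [sq_nonneg ((N - c) * b v + (2 * F.degree v - c)), mul_nonneg hd hc]
    · nlinarith [sq_nonneg ((N - c) * b v + 2 * F.degree v),
        mul_nonneg (mul_nonneg hM.le hc) (sq_nonneg (b v))]
  have hdsq : ∑ v ∈ W, (F.degree v : ℝ) ^ 2 ≤ 2 * f ^ 2 := by
    calc ∑ v ∈ W, (F.degree v : ℝ) ^ 2 ≤ ∑ v, (F.degree v : ℝ) ^ 2 :=
          Finset.sum_le_univ_sum_of_nonneg fun _ => sq_nonneg _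
      _ ≤ ∑ v, f * F.degree v := Finset.sum_le_sum fun v _ => by
          have : (F.degree v : ℝ) ≤ f := by
            rw [hf, Nat.cast_le, ← F.card_incidenceFinset_eq_degree]
            exact Finset.card_le_card (F.incidenceFinset_subset v)
          rw [sq]
          exact mul_le_mul_of_nonneg_right this (Nat.cast_nonneg _)
      _ = 2 * f ^ 2 := by rw [← Finset.mul_sum, hdegF]; ring
  have hc2 : ∑ v ∈ W, (if v ∈ Y then c ^ 2 else 0) = c ^ 2 * Y.card := by
    rw [← Finset.sum_filter, Finset.filter_mem_eq_inter, Finset.inter_eq_right.2 hYW,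
      Finset.sum_const, nsmul_eq_mul, mul_comm]
  calc (N - c) * (4 * f - c * Y.card) ≤ (N - c) * _ := mul_le_mul_of_nonneg_left hmain hM.le
    _ = _ := Finset.mul_sum _ _ _
    _ ≤ ∑ v ∈ W, (4 * (F.degree v : ℝ) ^ 2 + (if v ∈ Y then c ^ 2 else 0)) :=
        Finset.sum_le_sum hpt
    _ ≤ _ := by
        rw [Finset.sum_add_distrib, ← Finset.mul_sum, hc2]
        linarith

/-- An index of at least `2 (N - 1)` leaves room for at most `|X| |Y| / 4` non-edges in the clique
on the `N` vertices outside `X`. -/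
theorem four_mul_card_edgeFinset_le [Fintype V] [DecidableEq V] [Nonempty V] (G F : SimpleGraph V)
    [DecidableRel G.Adj] [DecidableRel F.Adj] {X Y : Finset V} (hXY : Disjoint X Y)
    (hXne : X.Nonempty) (hYne : Y.Nonempty)
    (hX : ∀ x ∈ X, ∀ v, G.Adj x v → v ∈ Y)
    (hF : ∀ u v, F.Adj u v → u ∉ X ∧ v ∉ X ∧ ¬ G.Adj u v)
    (hN : 8 * F.edgeFinset.card ^ 2 + 4 * Y.card * X.card ^ 2 + X.card * Y.card ^ 2 +
      2 * X.card < Xᶜ.card)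
    (hq : 2 * ((Xᶜ.card : ℝ) - 1) ≤ qIndex G) :
    4 * F.edgeFinset.card ≤ Y.card * X.card := by
  obtain ⟨x, hx0, hx⟩ := exists_eigenvector_qIndex G
  have hNr : 8 * (F.edgeFinset.card : ℝ) ^ 2 + 4 * Y.card * (X.card : ℝ) ^ 2 +
      X.card * (Y.card : ℝ) ^ 2 + 2 * X.card < Xᶜ.card := by exact_mod_cast hN
  have hYX : Y ⊆ Xᶜ := fun y hy => Finset.mem_compl.2 fun h => Finset.disjoint_left.1 hXY h hy
  have hFW : ∀ u v, F.Adj u v → u ∈ Xᶜ := fun u v h => Finset.mem_compl.2 (hF u v h).1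
  have ht1 : (1 : ℝ) ≤ X.card := by exact_mod_cast hXne.card_pos
  have hδ1 : (1 : ℝ) ≤ Y.card := by exact_mod_cast hYne.card_pos
  have hray : ∀ r : ℝ, _ := fun r => rayleigh_le G F hXY hX hF (x := fun v => r * x v)
    (q := qIndex G) (fun v => by rw [← Finset.mul_sum]; linear_combination r * hx v) hq
  have hdegX : ∀ v ∈ X, G.degree v ≤ Y.card := fun v hv => by
    rw [← SimpleGraph.card_neighborFinset_eq_degree]
    exact Finset.card_le_card fun u hu => hX v hv u ((SimpleGraph.mem_neighborFinset _ _ _).1 hu)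
  generalize ht : (X.card : ℝ) = t at *
  generalize hδ : (Y.card : ℝ) = δ at *
  generalize hNdef : (Xᶜ.card : ℝ) = N at *
  have hf0 : (0 : ℝ) ≤ F.edgeFinset.card := Nat.cast_nonneg _
  have hδt : δ ≤ δ * t ^ 2 := le_mul_of_one_le_right (by linarith) (one_le_pow₀ ht1)
  have hfsq := sq_nonneg (F.edgeFinset.card : ℝ)
  have htδ : 0 ≤ t * δ ^ 2 := by positivity
  have hNpos : 0 < N := by linarith
  have hg : N ≤ 2 * (N - 1) - δ := by linarith
  have hgpos : 0 < 2 * (N - 1) - δ := by linarith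
  set c : ℝ := t * (1 + δ / (2 * (N - 1) - δ)) with hc
  have hratio : δ / (2 * (N - 1) - δ) ≤ δ / N := by gcongr
  have hratio' : δ / N ≤ 1 := (div_le_one hNpos).2 (by linarith)
  have hratio0 : 0 ≤ δ / (2 * (N - 1) - δ) := by positivity
  have hc2 : c ≤ 2 * t := by
    rw [hc]; nlinarith
  have hc0 : 0 ≤ c := by rw [hc]; positivity
  have hform : ∀ r : ℝ, N * ∑ v ∈ Xᶜ, (r * x v) ^ 2 - (∑ v ∈ Xᶜ, r * x v) ^ 2 +
      (∑ v, ∑ u, if F.Adj v u then (r * x v + r * x u) ^ 2 else 0) / 2 ≤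
      c * ∑ u ∈ Y, (r * x u) ^ 2 := by
    intro r
    have h1 := hray r
    have h2 := sum_sum_add_sq_le X Y (fun v => r * x v) (l := 2 * (N - 1)) (by rw [hδ]; linarith)
    rw [hδ, ht] at h2
    linarith
  have hYsum : ∑ u ∈ Y, x u ^ 2 ≤ ∑ v ∈ Xᶜ, x v ^ 2 :=
    Finset.sum_le_sum_of_subset_of_nonneg hYX fun _ _ _ => sq_nonneg _
  have hWsum0 : 0 ≤ ∑ v ∈ Xᶜ, x v ^ 2 := Finset.sum_nonneg fun _ _ => sq_nonneg _
  -- The eigenvector can therefore be scaled to have sum `N` outside `X`.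
  have hS : ∑ v ∈ Xᶜ, x v ≠ 0 := by
    intro hS
    have h1 := hform 1
    simp only [one_mul, hS] at h1
    have h2 : 0 ≤ ∑ v, ∑ u, (if F.Adj v u then (x v + x u) ^ 2 else 0) :=
      Finset.sum_nonneg fun v _ => Finset.sum_nonneg fun u _ => by split_ifs <;> positivity
    have h3 : c * ∑ u ∈ Y, x u ^ 2 ≤ 2 * t * ∑ v ∈ Xᶜ, x v ^ 2 :=
      mul_le_mul hc2 hYsum (Finset.sum_nonneg fun _ _ => sq_nonneg _) (by linarith)
    have h4 : ∑ v ∈ Xᶜ, x v ^ 2 ≤ 0 := by nlinarith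
    have h5 := (Finset.sum_eq_zero_iff_of_nonneg fun v _ => sq_nonneg (x v)).1
      (le_antisymm h4 hWsum0)
    have h6 : ∀ v ∉ X, x v = 0 := fun v hv => by simpa using h5 v (Finset.mem_compl.2 hv)
    refine hx0 (funext fun v => ?_)
    by_cases hv : v ∈ X
    · have h7 := hx v
      rw [Finset.sum_eq_zero fun u hu => h6 u (Finset.mem_compl.1 (hYX (hX v hv u
        ((SimpleGraph.mem_neighborFinset _ _ _).1 hu))))] at h7
      have h8 : (G.degree v : ℝ) ≤ δ := by rw [← hδ]; exact_mod_cast hdegX v hv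
      have h9 : (qIndex G - G.degree v) * x v = 0 := by linarith
      rcases mul_eq_zero.1 h9 with h | h
      · linarith
      · exact h
    · exact h6 v hv
  set S := ∑ v ∈ Xᶜ, x v with hSdef
  have key := quadratic_form_bound F (W := Xᶜ) (Y := Y) hYX hFW (x := fun v => N / S * x v)
    (c := c) hc0 (by rw [hNdef]; linarith)
    (by rw [← Finset.mul_sum, ← hSdef, hNdef]; field_simp)
    (by rw [hNdef]; exact hform (N / S))
  rw [hNdef, hδ] at key
  by_contra hcon
  have hf : δ * t + 1 ≤ 4 * (F.edgeFinset.card : ℝ) := by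
    rw [← hδ, ← ht]; exact_mod_cast not_le.1 hcon
  have hcδ : c * δ ≤ t * δ + t * δ * (δ / N) := by
    rw [hc]
    nlinarith [mul_le_mul_of_nonneg_left hratio (show 0 ≤ t * δ by positivity)]
  have hNe : N * (1 - t * δ * (δ / N)) = N - t * δ ^ 2 := by field_simp
  have he1 : 1 - t * δ * (δ / N) ≤ 1 := by
    have : 0 ≤ t * δ * (δ / N) := by positivity
    linarith
  have he0 : 0 < 1 - t * δ * (δ / N) := by
    refine pos_of_mul_pos_right (a := N) ?_ hNpos.le
    rw [hNe]; linarith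
  have h1 : (N - c) * (1 - t * δ * (δ / N)) ≤ (N - c) * (4 * F.edgeFinset.card - c * δ) :=
    mul_le_mul_of_nonneg_left (by linarith) (by linarith)
  have h2 : N - t * δ ^ 2 - 2 * t ≤ (N - c) * (1 - t * δ * (δ / N)) := by
    have := mul_le_mul_of_nonneg_left he1 hc0
    rw [sub_mul, hNe]
    linarith
  have h3 : c ^ 2 * δ ≤ (2 * t) ^ 2 * δ := by gcongr
  linarith

/-! ### The family `𝓑₁(n,k,δ)` -/

theorem graphB_adj_iff (n k δ : ℕ) (a b : BVert n k δ) :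
    (graphB n k δ).Adj a b ↔ a ≠ b ∧ (a ∈ partX n k δ → b.isLeft) ∧
      (b ∈ partX n k δ → a.isLeft) := by
  rcases a with a | a | a <;> rcases b with b | b | b <;>
    simp [graphB, join, partX]

theorem countP_eq_card {w : List V} (hw : w.Nodup) (hall : ∀ v, v ∈ w) {p : V → Prop}
    [DecidablePred p] (s : Finset V) (hs : ∀ v, v ∈ s ↔ p v) :
    w.countP (fun v => p v) = s.card := by
  classical
  rw [countP_eq_card_filter hw]
  congr 1
  ext v
  simp [hall, hs]

/-- Removing the `δ` vertices of `Y` from `k` disjoint paths leaves at most `δ + k` pieces, too few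
for the `δ + k` isolated vertices of `X` and the nonempty rest. -/
theorem MemFamilyB1.not_hasArrangement {G : SimpleGraph V} {n k δ : ℕ} (hn : 2 * δ + k < n)
    (h : MemFamilyB1 n k δ G) : ¬ HasArrangement G k := by
  classical
  obtain ⟨E', -, -, ⟨φ⟩⟩ := h
  rintro ⟨w, hnd, hall, hb⟩
  rw [← breaks_map G _ φ] at hb
  have hnd' : (w.map φ).Nodup := hnd.map φ.injective
  have hall' : ∀ v, v ∈ w.map φ := fun v => List.mem_map.2 ⟨φ.symm v, hall _, by simp⟩
  have key := countP_le_countP_add_breaks ((graphB n k δ).deleteEdges (E' : Set _)) (partX n k δ)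
    (Set.range Sum.inl) (fun x hx v hxv => by
      rw [SimpleGraph.deleteEdges_adj, graphB_adj_iff] at hxv
      obtain ⟨y, rfl⟩ := Sum.isLeft_iff.1 (hxv.1.2.1 hx)
      exact ⟨y, rfl⟩) (by
      rw [Set.disjoint_left]
      rintro _ ⟨i, rfl⟩
      simp) (w.map φ) (List.ne_nil_of_mem (hall' (Sum.inr (Sum.inl ⟨0, by omega⟩))))
  rw [if_pos ⟨Sum.inr (Sum.inl ⟨0, by omega⟩), hall' _, by simp [partX], by simp⟩] at key
  have hX := @countP_eq_card _ _ hnd' hall' (· ∈ partX n k δ) (fun _ => Classical.propDecidable _)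
    (Finset.univ.image (Sum.inr ∘ Sum.inr : Fin (δ + k) → BVert n k δ)) (fun v => by simp [partX])
  have hY := @countP_eq_card _ _ hnd' hall' (· ∈ Set.range Sum.inl)
    (fun _ => Classical.propDecidable _) (Finset.univ.image fun i : Fin δ => Sum.inl i)
    (fun v => by simp)
  rw [Finset.card_image_of_injective _ (Sum.inr_injective.comp Sum.inr_injective),
    Finset.card_univ, Fintype.card_fin] at hX
  rw [Finset.card_image_of_injective _ Sum.inl_injective, Finset.card_univ,
    Fintype.card_fin] at hY
  rw [hX, hY] at key
  split_ifs at key <;> omega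

/-- The graph of the edges that `G` misses outside the vertex set `X`. -/
def missingGraph (G : SimpleGraph V) (X : Finset V) : SimpleGraph V where
  Adj u v := u ≠ v ∧ u ∉ X ∧ v ∉ X ∧ ¬ G.Adj u v
  symm := ⟨fun _ _ h => ⟨h.1.symm, h.2.2.1, h.2.1, fun h' => h.2.2.2 h'.symm⟩⟩
  loopless := ⟨fun _ h => h.1 rfl⟩

/-- A graph in which `X` is independent and completely joined to `Y`, and has no other neighbours,
belongs to `𝓑₁` as soon as few edges are missing outside `X`. -/
theorem memFamilyB1_of_missingGraph [Fintype V] [DecidableEq V] (G : SimpleGraph V) {n k δ : ℕ}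
    (hn : Fintype.card V = n) {X Y : Finset V} (hXY : Disjoint X Y) (hXcard : X.card = δ + k)
    (hYcard : Y.card = δ) (hX : ∀ x ∈ X, ∀ v, G.Adj x v ↔ v ∈ Y)
    [DecidableRel (missingGraph G X).Adj]
    (hcard : (missingGraph G X).edgeFinset.card ≤ δ * (δ + k) / 4) : MemFamilyB1 n k δ G := by
  classical
  have hle : (X ∪ Y).card ≤ n := hn ▸ Finset.card_le_univ _
  rw [Finset.card_union_of_disjoint hXY] at hle
  have hZcard : (X ∪ Y)ᶜ.card = n - 2 * δ - k := by
    rw [Finset.card_compl, Finset.card_union_of_disjoint hXY]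
    omega
  let eX := (X.equivFinOfCardEq hXcard).symm
  let eY := (Y.equivFinOfCardEq hYcard).symm
  let eZ := ((X ∪ Y)ᶜ.equivFinOfCardEq hZcard).symm
  let f : BVert n k δ → V := Sum.elim (fun i => eY i) (Sum.elim (fun i => eZ i) (fun i => eX i))
  have hYX : ∀ v ∈ Y, v ∉ X := fun v hv hv' => Finset.disjoint_left.1 hXY hv' hv
  have hZ : ∀ i, (eZ i : V) ∉ X ∧ (eZ i : V) ∉ Y := fun i => by
    have := (eZ i).2
    simpa using this
  have hfX : ∀ a, a ∈ partX n k δ ↔ f a ∈ X := by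
    rintro (i | i | i)
    · simpa [partX, f] using hYX _ (eY i).2
    · simpa [partX, f] using (hZ i).1
    · simp [partX, f]
  have hfY : ∀ a, a.isLeft ↔ f a ∈ Y := by
    rintro (i | i | i)
    · simp [f]
    · simpa [f] using (hZ i).2
    · simpa [f] using Finset.disjoint_left.1 hXY (eX i).2
  have hinj : Function.Injective f := by
    intro a b hab
    have h1 := (hfX a).trans ((iff_of_eq (congrArg (· ∈ X) hab)).trans (hfX b).symm)
    have h2 := (hfY a).trans ((iff_of_eq (congrArg (· ∈ Y) hab)).trans (hfY b).symm)
    rcases a with a | a | a <;> rcases b with b | b | b <;> simp [partX] at h1 h2 <;>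
      simpa [f, Subtype.ext_iff.symm] using hab
  have hbij : Function.Bijective f := by
    rw [Fintype.bijective_iff_injective_and_card]
    refine ⟨hinj, ?_⟩
    simp only [Fintype.card_sum, Fintype.card_fin, hn]
    omega
  let e := Equiv.ofBijective f hbij
  have hE : ∀ a b, s(a, b) ∈ ((missingGraph G X).comap f).edgeFinset ↔
      (missingGraph G X).Adj (f a) (f b) := fun a b => by
    simp
  refine ⟨((missingGraph G X).comap f).edgeFinset, ?_, ?_, ⟨RelIso.symm ⟨e, ?_⟩⟩⟩
  · intro p
    induction p with
    | _ a b =>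
      intro hp
      rw [Finset.mem_coe, hE] at hp
      obtain ⟨h1, h2, h3, -⟩ := hp
      refine ⟨?_, ?_⟩
      · rw [SimpleGraph.mem_edgeSet, graphB_adj_iff]
        refine ⟨fun h => h1 (congrArg f h), fun h => absurd ((hfX a).1 h) h2,
          fun h => absurd ((hfX b).1 h) h3⟩
      · intro v hv
        rw [hfX]
        rcases Sym2.mem_iff.1 hv with rfl | rfl
        · exact h2
        · exact h3
  · refine le_trans (le_of_eq ?_) hcard
    exact (SimpleGraph.Iso.comap e (missingGraph G X)).card_edgeFinset_eq
  · intro a b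
    change G.Adj (f a) (f b) ↔ _
    rw [SimpleGraph.deleteEdges_adj, Finset.mem_coe, hE, graphB_adj_iff, hfX, hfX, hfY, hfY,
      ← hinj.ne_iff]
    have h1 : f a ∈ X → (G.Adj (f a) (f b) ↔ f b ∈ Y) := fun h => hX _ h _
    have h2 : f b ∈ X → (G.Adj (f a) (f b) ↔ f a ∈ Y) := fun h => by
      rw [G.adj_comm]; exact hX _ h _
    have h3 := hYX (f a)
    have h4 := hYX (f b)
    have h5 : f a ∈ X → f b ∉ X → f a ≠ f b := fun h h' h'' => h' (h'' ▸ h)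
    have h6 : f b ∈ X → f a ∉ X → f a ≠ f b := fun h h' h'' => h' (h''.symm ▸ h)
    by_cases ha : f a ∈ X
    · rw [h1 ha]
      exact ⟨fun h => ⟨⟨h5 ha (h4 h), fun _ => h, fun h' => absurd h' (h4 h)⟩, fun h' => h'.2.1 ha⟩,
        fun h => h.1.2.1 ha⟩
    by_cases hb : f b ∈ X
    · rw [h2 hb]
      exact ⟨fun h => ⟨⟨h6 hb (h3 h), fun h' => absurd h' (h3 h), fun _ => h⟩,
        fun h' => h'.2.2.1 hb⟩, fun h => h.1.2.2 hb⟩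
    · exact ⟨fun h => ⟨⟨h.ne, fun h' => absurd h' ha, fun h' => absurd h' hb⟩,
        fun h' => h'.2.2.2 h⟩, fun h => by_contra fun h' => h.2 ⟨h.1.1, ha, hb, h'⟩⟩

theorem exists_le_card_edgeFinset_eq [Fintype V] [DecidableEq V] (H : SimpleGraph V)
    [DecidableRel H.Adj] {m : ℕ} (hm : m ≤ H.edgeFinset.card) :
    ∃ F ≤ H, ∀ [Fintype F.edgeSet], F.edgeFinset.card = m := by
  obtain ⟨s, hs, rfl⟩ := Finset.exists_subset_card_eq hm
  refine ⟨SimpleGraph.fromEdgeSet (s : Set (Sym2 V)), fun u v h => ?_, ?_⟩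
  · simpa using hs h.1
  · intro _
    congr 1
    ext p
    refine SimpleGraph.mem_edgeFinset.trans ?_
    rw [SimpleGraph.edgeSet_fromEdgeSet]
    exact ⟨fun h => h.1, fun h => ⟨h, SimpleGraph.not_isDiag_of_mem_edgeFinset (hs h)⟩⟩

/-- The two consequences of the lower bound on `n`: the order is large enough for the counting of
non-adjacent pairs, and for the error terms of the index estimate when one edge more than
`⌊δ(δ+k)/4⌋` is deleted. -/
theorem order_bounds {n k δ : ℕ} (hk : 1 ≤ k) (hδ : 2 ≤ δ)
    (hn : (δ ^ 2 + k * δ + 7 * δ + 6 * k + 9) * (δ ^ 2 + k * δ + 1) ≤ n) :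
    8 * (δ + k) * (δ + k) + 7 * (δ + k) < n ∧
    8 * (δ * (δ + k) / 4 + 1) ^ 2 + 4 * δ * (δ + k) ^ 2 + (δ + k) * δ ^ 2 + 2 * (δ + k) <
      n - (δ + k) := by
  set t := δ + k with ht
  -- With `p = δ t`, everything is bounded by polynomials in `p`, `t` and `δ`, where `δ ≤ t ≤ p / 2`.
  obtain ⟨p, hp⟩ : ∃ p, p = δ * t := ⟨_, rfl⟩
  have hp2 : 2 * t ≤ p := by rw [hp]; exact Nat.mul_le_mul_right _ hδ
  have ht3 : 3 ≤ t := by omega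
  have hn' : (p + 6 * t + δ + 9) * (p + 1) ≤ n := by
    refine le_trans (le_of_eq ?_) hn
    rw [hp, ht]; ring
  have h1 : (8 * t + 9) * (2 * t + 1) ≤ n :=
    le_trans (Nat.mul_le_mul (by omega) (by omega)) hn'
  have hf : 4 * (p / 4 + 1) ≤ p + 4 := by omega
  have hf2 : 16 * (p / 4 + 1) ^ 2 ≤ (p + 4) ^ 2 := by
    calc 16 * (p / 4 + 1) ^ 2 = (4 * (p / 4 + 1)) ^ 2 := by ring
      _ ≤ (p + 4) ^ 2 := Nat.pow_le_pow_left hf 2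
  have hδt : p * δ ≤ p * t := Nat.mul_le_mul_left _ (by omega)
  have e1 : 4 * δ * t ^ 2 = 4 * (p * t) := by rw [hp]; ring
  have e2 : t * δ ^ 2 = p * δ := by rw [hp]; ring
  rw [← hp, e1, e2]
  refine ⟨by nlinarith, ?_⟩
  have : 8 * (p / 4 + 1) ^ 2 + 4 * (p * t) + p * δ + 2 * t + t < n := by
    nlinarith
  omega

end PathCover

theorem theorem1p4 {V : Type*} [Fintype V] [DecidableEq V] (G : SimpleGraph V)
    [DecidableRel G.Adj] (n k δ : ℕ) (hk : 1 ≤ k) (hδ : 2 ≤ δ)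
    (hn : Fintype.card V = n)
    (hn_large : (δ ^ 2 + k * δ + 7 * δ + 6 * k + 9) * (δ ^ 2 + k * δ + 1) ≤ n)
    (hconn : G.Connected) (hdeg : δ ≤ G.minDegree)
    (hq : 2 * ((n : ℝ) - δ - k - 1) ≤ PathCover.qIndex G) :
    PathCover.IsPathCoverable G k ↔ ¬ PathCover.MemFamilyB1 n k δ G := by
  classical
  have : Nonempty V := hconn.nonempty
  obtain ⟨hn₁, hn₂⟩ := PathCover.order_bounds hk hδ hn_large
  have hdeg' : ∀ v, δ ≤ G.degree v := fun v => hdeg.trans (G.minDegree_le_degree v)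
  have hn₃ : 2 * (δ + k) + 1 < n := by nlinarith
  refine ⟨fun hcov hmem => hmem.not_hasArrangement (by omega) hcov.hasArrangement, fun hmem => ?_⟩
  by_contra hcov
  refine hmem ?_
  have hsum := PathCover.le_sum_degree_of_le_qIndex G (t := δ + k) (by omega)
    (fun v => le_trans (by omega) (hdeg' v)) (by rw [hn]; push_cast; linarith)
  obtain ⟨X, Y, hXY, hXcard, hYcard, hX⟩ :=
    PathCover.exists_independent_of_not_hasArrangement G hk rfl (by omega) hconn hdeg' hsum
      fun h => hcov (PathCover.isPathCoverable_of_hasArrangement G h)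
  refine PathCover.memFamilyB1_of_missingGraph G hn hXY hXcard hYcard hX ?_
  by_contra hlt
  -- One missing edge more than allowed already contradicts the bound on the index.
  obtain ⟨F, hF, hFcard⟩ := PathCover.exists_le_card_edgeFinset_eq
    (PathCover.missingGraph G X) (m := δ * (δ + k) / 4 + 1) (by omega)
  have hXc : Xᶜ.card = n - (δ + k) := by rw [Finset.card_compl, hn, hXcard]
  have key := PathCover.four_mul_card_edgeFinset_le G F hXY
    (Finset.card_pos.1 (by omega)) (Finset.card_pos.1 (by omega)) (fun x hx v h => (hX x hx v).1 h)
    (fun u v h => (hF h).2)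
    (by rw [hFcard, hYcard, hXcard, hXc]; exact hn₂)
    (by rw [hXc, Nat.cast_sub (by omega)]; push_cast; linarith)
  rw [hFcard, hYcard, hXcard] at key
  omega
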